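/- Let $n\ge 2$ be an integer, let $1<p<n$ and $1\le\alpha<n/p$, and let $\Omega\subset\mathbb R^n$ be an open set with $|\Omega|<\infty$. For $\beta\ge 0$ and a locally integrable function $v$ on $\Omega$, the local fractional maximal function of $v$ is $$\mathcal M_{\beta,\Omega}v(x)=\sup_{0<r<\operatorname{dist}(x,\mathbb R^n\setminus\Omega)} r^{\beta}\,\frac1{|B(x,r)|}\int_{B(x,r)}|v(y)|\,dy\in[0,\infty],\qquad x\in\Omega .$$ Let $u\in W^{1,p}(\Omega)$, with weak gradient $Du$. Then $\mathcal M_{\alpha,\Omega}u$ is finite almost everywhere in $\Omega$ and $$\mathcal M_{\alpha,\Omega}u\in W^{1,q}(\Omega),\qquad q=\frac{np}{n-(\alpha-1)p}.$$ Moreover, its weak gradient $D\mathcal M_{\alpha,\Omega}u$ satisfies $$|D\mathcal M_{\alpha,\Omega}u(x)|\le 2\,\mathcal M_{\alpha,\Omega}|Du|(x)+\alpha\,\mathcal M_{\alpha-1,\Omega}u(x)$$ for almost every $x\in\Omega$, where $|\cdot|$ is the Euclidean norm. -/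

import Mathlib

open MeasureTheory
open scoped ENNReal

/-- The local fractional maximal function `M_{α,Ω} u`, with values in `[0, ∞]`:
the supremum of `r ^ α` times the average of `|u|` over `B(x, r)`, over all radii
`0 < r < dist(x, ℝⁿ ∖ Ω)`. The distance is `∞` when `Ω` is the whole space. -/
noncomputable def localFracMax {n : ℕ} (α : ℝ) (Ω : Set (EuclideanSpace ℝ (Fin n)))
    (u : EuclideanSpace ℝ (Fin n) → ℝ) (x : EuclideanSpace ℝ (Fin n)) : ℝ≥0∞ :=
  ⨆ (r : ℝ) (_ : 0 < r) (_ : ENNReal.ofReal r < Metric.infEDist x Ωᶜ),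
    ENNReal.ofReal r ^ α * ⨍⁻ y in Metric.ball x r, ‖u y‖ₑ ∂volume

/-- `g` is a weak (distributional) gradient of `u` in the open set `Ω`: both are locally
integrable in `Ω` and `∫_Ω u ∂ᵢφ = - ∫_Ω gᵢ φ` for every `φ ∈ C_c^∞(Ω)` and every `i`. -/
def HasWeakGradient {n : ℕ} (Ω : Set (EuclideanSpace ℝ (Fin n)))
    (u : EuclideanSpace ℝ (Fin n) → ℝ)
    (g : EuclideanSpace ℝ (Fin n) → EuclideanSpace ℝ (Fin n)) : Prop :=
  LocallyIntegrableOn u Ω ∧ LocallyIntegrableOn g Ω ∧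
    ∀ φ : EuclideanSpace ℝ (Fin n) → ℝ, ContDiff ℝ ((⊤ : ℕ∞) : WithTop ℕ∞) φ → HasCompactSupport φ →
      tsupport φ ⊆ Ω → ∀ i : Fin n,
        ∫ x in Ω, u x * fderiv ℝ φ x (EuclideanSpace.single i 1) = - ∫ x in Ω, g x i * φ x

/-- `u ∈ W^{1,p}(Ω)`: `u ∈ L^p(Ω)` and `u` has a weak gradient in `L^p(Ω)`. -/
def MemSobolevOne {n : ℕ} (p : ℝ≥0∞) (Ω : Set (EuclideanSpace ℝ (Fin n)))
    (u : EuclideanSpace ℝ (Fin n) → ℝ) : Prop :=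
  MemLp u p (volume.restrict Ω) ∧
    ∃ g : EuclideanSpace ℝ (Fin n) → EuclideanSpace ℝ (Fin n),
      HasWeakGradient Ω u g ∧ MemLp g p (volume.restrict Ω)

open Metric Set Filter Topology
open scoped Convolution
open ContinuousLinearMap (lsmul)


/-! Write M = M_α u and H = 2 M_α|Du| + α M_{α-1} u. Everything rests on one inequality along
segments in Ω: M(x+v) ≤ M(x) + |v| ∫₀¹ H(x+θv) dθ (`HasWeakGradient.localFracMax_le_add`).

To see it, fix an admissible radius r at x+v and let R(θ) be the same fraction of dist(x+θv, Ωᶜ)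
that r is at θ = 1. Then R(θ) is always admissible and is |v|-Lipschitz. Differentiate R^α times the
average of |u| over B(x+θv, R): the power contributes at most |v| α R^{α-1} times the average of
|u|. The average contributes at most 2|v| R^α times the average of |Du|, once for the motion of the
centre and once for that of the radius. Integrate and take the supremum over r. The estimate for
averages is `HasWeakGradient.eventually_setLAverage_enorm_sub_le`, proved by mollification.

Integrability comes from Hedberg's inequality and the Hardy-Littlewood theorem: M_β maps L^p into
L^{np/(n-βp)}. For β = α-1 this exponent is q; for β = α it is at least q, and |Ω| < ∞ brings it
down to q.

Finally, difference quotients turn the segment inequality into |∫ M ∂_e φ| ≤ |e| ∫ H|φ|. Riesz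
representation in L²(H dx) then produces a weak gradient, and testing with mollifiers shows that any
weak gradient is at most H almost everywhere. -/

/-! ### Elementary properties and lower semicontinuity of the maximal function -/

theorem lt_localFracMax_iff {n : ℕ} {α : ℝ} {Ω : Set (EuclideanSpace ℝ (Fin n))}
    {u : EuclideanSpace ℝ (Fin n) → ℝ} {x : EuclideanSpace ℝ (Fin n)} {c : ℝ≥0∞} :
    c < localFracMax α Ω u x ↔ ∃ r : ℝ, 0 < r ∧ ENNReal.ofReal r < infEDist x Ωᶜ ∧
      c < ENNReal.ofReal r ^ α * ⨍⁻ y in ball x r, ‖u y‖ₑ ∂volume := by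
  simp only [localFracMax, lt_iSup_iff, exists_prop]

theorem le_localFracMax {n : ℕ} {α : ℝ} {Ω : Set (EuclideanSpace ℝ (Fin n))}
    {u : EuclideanSpace ℝ (Fin n) → ℝ} {x : EuclideanSpace ℝ (Fin n)} {r : ℝ} (hr : 0 < r)
    (hrx : ENNReal.ofReal r < infEDist x Ωᶜ) :
    ENNReal.ofReal r ^ α * ⨍⁻ y in ball x r, ‖u y‖ₑ ∂volume ≤ localFracMax α Ω u x :=
  le_iSup₂_of_le r hr <| le_iSup_of_le hrx le_rfl

theorem closedBall_subset_of_ofReal_lt_infEDist {X : Type*} [PseudoMetricSpace X] {Ω : Set X}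
    {x : X} {r : ℝ} (hrx : ENNReal.ofReal r < infEDist x Ωᶜ) : closedBall x r ⊆ Ω := by
  intro y hy
  by_contra hyΩ
  refine (infEDist_le_edist_of_mem (x := x) (mem_compl hyΩ)).not_gt (lt_of_le_of_lt ?_ hrx)
  rw [edist_dist, dist_comm]
  exact ENNReal.ofReal_le_ofReal hy

/-- Admissible balls lie in Ω, so null sets and values outside Ω never enter an average. The
equality holds at every point, which later allows a change of representative inside pointwise
inequalities. -/
theorem localFracMax_congr {n : ℕ} {α : ℝ} {Ω : Set (EuclideanSpace ℝ (Fin n))}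
    {u v : EuclideanSpace ℝ (Fin n) → ℝ} (h : ∀ᵐ x ∂(volume.restrict Ω), ‖u x‖ = ‖v x‖) :
    localFracMax α Ω u = localFracMax α Ω v := by
  funext x
  refine iSup_congr fun r => iSup_congr fun hr => iSup_congr fun hrx => ?_
  congr 1
  refine laverage_congr ?_
  have hsub : ball x r ⊆ Ω :=
    ball_subset_closedBall.trans (closedBall_subset_of_ofReal_lt_infEDist hrx)
  filter_upwards [ae_mono (Measure.restrict_mono hsub le_rfl) h] with y hy
  rw [← ofReal_norm, ← ofReal_norm, hy]

theorem localFracMax_mono_set {n : ℕ} {α : ℝ} {Ω Ω' : Set (EuclideanSpace ℝ (Fin n))}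
    (h : Ω ⊆ Ω') (u : EuclideanSpace ℝ (Fin n) → ℝ) (x : EuclideanSpace ℝ (Fin n)) :
    localFracMax α Ω u x ≤ localFracMax α Ω' u x :=
  iSup_mono fun _ => iSup_mono fun _ => iSup_le fun hrx =>
    le_iSup_of_le (hrx.trans_le (infEDist_anti (compl_subset_compl.2 h))) le_rfl

/-- Continuity from below of the measure with density `f`; in this form `f` need not be measurable.
-/
theorem setLIntegral_ball_eq_iSup {X : Type*} [PseudoMetricSpace X] [MeasurableSpace X]
    [OpensMeasurableSpace X] (μ : Measure X) (f : X → ℝ≥0∞) (x : X) (r : ℝ) :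
    ∫⁻ y in ball x r, f y ∂μ = ⨆ k : ℕ, ∫⁻ y in ball x (r - 1 / (k + 1)), f y ∂μ := by
  have hU : ball x r = ⋃ k : ℕ, ball x (r - 1 / (k + 1)) := by
    ext y
    simp only [mem_ball, mem_iUnion]
    constructor
    · intro h
      obtain ⟨k, hk⟩ := exists_nat_one_div_lt (sub_pos.2 h)
      exact ⟨k, by linarith⟩
    · rintro ⟨k, hk⟩
      have : (0 : ℝ) < 1 / (k + 1) := by positivity
      linarith
  have hmono : Monotone fun k : ℕ => ball x (r - 1 / ((k : ℝ) + 1)) := by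
    intro k l hkl
    apply ball_subset_ball
    have : (1 : ℝ) / (l + 1) ≤ 1 / (k + 1) := by gcongr
    linarith
  have := hmono.measure_iUnion (μ := μ.withDensity f)
  rw [← hU, withDensity_apply _ measurableSet_ball] at this
  simpa only [withDensity_apply _ measurableSet_ball] using this

/-- An admissible radius stays admissible for nearby centres, and B(x, r-ε) ⊆ B(y, r) once |x-y| <
ε, while the volume depends on the radius alone. -/
theorem lowerSemicontinuous_localFracMax {n : ℕ} (α : ℝ) (Ω : Set (EuclideanSpace ℝ (Fin n)))
    (u : EuclideanSpace ℝ (Fin n) → ℝ) : LowerSemicontinuous (localFracMax α Ω u) := by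
  intro x c hc
  obtain ⟨r, hr, hrx, hcr⟩ := lt_localFracMax_iff.1 hc
  rw [setLAverage_eq, setLIntegral_ball_eq_iSup, ENNReal.iSup_div, ENNReal.mul_iSup,
    lt_iSup_iff] at hcr
  obtain ⟨k, hk⟩ := hcr
  have h1 : ∀ᶠ y in 𝓝 x, ENNReal.ofReal r < infEDist y Ωᶜ :=
    continuous_infEDist.continuousAt.eventually (lt_mem_nhds hrx)
  have h2 : ∀ᶠ y in 𝓝 x, dist y x < 1 / (k + 1) := ball_mem_nhds x (by positivity)
  filter_upwards [h1, h2] with y hy1 hy2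
  refine lt_localFracMax_iff.2 ⟨r, hr, hy1, hk.trans_le ?_⟩
  rw [setLAverage_eq, Measure.addHaar_ball_center volume x, Measure.addHaar_ball_center volume y]
  gcongr
  apply ball_subset_ball'
  rw [dist_comm]
  linarith

theorem measurable_localFracMax {n : ℕ} (α : ℝ) (Ω : Set (EuclideanSpace ℝ (Fin n)))
    (u : EuclideanSpace ℝ (Fin n) → ℝ) : Measurable (localFracMax α Ω u) :=
  (lowerSemicontinuous_localFracMax α Ω u).measurable

/-! ### The Hardy-Littlewood maximal theorem -/

/-- Weak (1,1) bound by Vitali's covering lemma: disjoint balls with large averages, enlarged 5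
times, cover the level set, which costs the factor 5^n. -/
theorem mul_measure_setOf_lt_localFracMax_le {n : ℕ} (u : EuclideanSpace ℝ (Fin n) → ℝ)
    (t : ℝ≥0∞) :
    t * volume {x | t < localFracMax 0 univ u x} ≤ 5 ^ n * ∫⁻ x, ‖u x‖ₑ := by
  set f : EuclideanSpace ℝ (Fin n) → ℝ≥0∞ := fun x => ‖u x‖ₑ with hf
  -- Vitali's lemma needs bounded radii. The bound obtained for radii at most N does not depend on
  -- N.
  let S : ℕ → Set (EuclideanSpace ℝ (Fin n)) := fun N =>
    {x | ∃ r : ℝ, 0 < r ∧ r ≤ N ∧ t * volume (ball x r) ≤ ∫⁻ y in ball x r, f y}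
  have hsub : {x | t < localFracMax 0 univ u x} ⊆ ⋃ N, S N := by
    intro x hx
    obtain ⟨r, hr, -, h⟩ := lt_localFracMax_iff.1 hx
    obtain ⟨N, hN⟩ := exists_nat_ge r
    refine mem_iUnion.2 ⟨N, r, hr, hN, ?_⟩
    rw [ENNReal.rpow_zero, one_mul, setLAverage_eq] at h
    exact (ENNReal.le_div_iff_mul_le (Or.inl (measure_ball_pos _ _ hr).ne')
      (Or.inl measure_ball_lt_top.ne)).1 h.le
  have hmono : Monotone S := fun N N' h x ⟨r, hr, hrN, hx⟩ =>
    ⟨r, hr, hrN.trans (by exact_mod_cast h), hx⟩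
  have key : ∀ N, t * volume (S N) ≤ 5 ^ n * ∫⁻ x, f x := by
    intro N
    choose! r hr0 hrN hr using fun x (hx : x ∈ S N) => hx
    obtain ⟨w, hwS, hdisj, hcov⟩ := Vitali.exists_disjoint_subfamily_covering_enlargement_closedBall
      (S N) (fun x => x) r N hrN 5 (by norm_num)
    have hwc : w.Countable := by
      refine hdisj.countable_of_nonempty_interior fun x hx => ?_
      exact (nonempty_ball.2 (hr0 x (hwS hx))).mono ball_subset_interior_closedBall
    have hScov : S N ⊆ ⋃ x ∈ w, closedBall x (5 * r x) := by
      intro x hx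
      obtain ⟨b, hb, hxb⟩ := hcov x hx
      exact mem_biUnion hb (hxb (mem_closedBall_self (hr0 x hx).le))
    have hball : ∀ x ∈ w, t * volume (closedBall x (5 * r x)) ≤
        5 ^ n * ∫⁻ y in ball x (r x), f y := by
      intro x hx
      have h0 := hr0 x (hwS hx)
      calc t * volume (closedBall x (5 * r x))
          = 5 ^ n * (t * volume (ball x (r x))) := by
            rw [Measure.addHaar_closedBall _ _ (by positivity), Measure.addHaar_ball_of_pos _ _ h0,
              finrank_euclideanSpace_fin, mul_pow, ENNReal.ofReal_mul (by positivity),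
              ENNReal.ofReal_pow (by norm_num), ENNReal.ofReal_ofNat]
            ring
        _ ≤ _ := by gcongr; exact hr x (hwS hx)
    have := hwc.to_subtype
    calc t * volume (S N) ≤ t * ∑' x : w, volume (closedBall (x : EuclideanSpace ℝ (Fin n)) (5 * r x)) := by
          gcongr
          exact (measure_mono hScov).trans (measure_biUnion_le _ hwc _)
      _ ≤ ∑' x : w, 5 ^ n * ∫⁻ y in ball (x : EuclideanSpace ℝ (Fin n)) (r x), f y := by
          rw [← ENNReal.tsum_mul_left]
          exact ENNReal.tsum_le_tsum fun x => hball x x.2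
      _ = 5 ^ n * ∫⁻ y in ⋃ x ∈ w, ball x (r x), f y := by
          rw [ENNReal.tsum_mul_left, lintegral_biUnion hwc (fun _ _ => measurableSet_ball)
            (hdisj.mono fun x => ball_subset_closedBall)]
      _ ≤ _ := by gcongr; exact Measure.restrict_le_self
  calc t * volume {x | t < localFracMax 0 univ u x} ≤ t * volume (⋃ N, S N) := by gcongr
    _ = ⨆ N, t * volume (S N) := by rw [hmono.measure_iUnion, ENNReal.mul_iSup]
    _ ≤ _ := iSup_le key

theorem lintegral_Ioi_indicator_rpow (a : ℝ≥0∞) {p : ℝ} (hp : 0 < p) :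
    ∫⁻ t in Ioi (0 : ℝ), {t : ℝ | ENNReal.ofReal t < a}.indicator
      (fun t => ENNReal.ofReal (p * t ^ (p - 1))) t = a ^ p := by
  have hms : ∀ a : ℝ≥0∞, MeasurableSet {t : ℝ | ENNReal.ofReal t < a} := fun a =>
    measurableSet_lt ENNReal.measurable_ofReal measurable_const
  have hfin : ∀ b : ℝ, 0 ≤ b → ∫⁻ t in Ioi (0 : ℝ), {t : ℝ | ENNReal.ofReal t < ENNReal.ofReal b}.indicator
      (fun t => ENNReal.ofReal (p * t ^ (p - 1))) t = ENNReal.ofReal b ^ p := by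
    intro b hb
    rw [lintegral_indicator (hms _), Measure.restrict_restrict (hms _)]
    have : {t : ℝ | ENNReal.ofReal t < ENNReal.ofReal b} ∩ Ioi 0 = Ioo 0 b := by
      ext t
      simp only [mem_inter_iff, mem_ofPred_eq, mem_Ioi, mem_Ioo]
      constructor
      · rintro ⟨h, h0⟩
        exact ⟨h0, (ENNReal.ofReal_lt_ofReal_iff_of_nonneg h0.le).1 h⟩
      · rintro ⟨h0, h⟩
        exact ⟨(ENNReal.ofReal_lt_ofReal_iff_of_nonneg h0.le).2 h, h0⟩
    rw [this, restrict_Ioo_eq_restrict_Ioc, ← ofReal_integral_eq_lintegral_ofReal,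
      ← intervalIntegral.integral_of_le hb, intervalIntegral.integral_const_mul,
      integral_rpow (Or.inl (by linarith)), ENNReal.ofReal_rpow_of_nonneg hb hp.le]
    · congr 1
      rw [sub_add_cancel, Real.zero_rpow hp.ne']
      field_simp
      ring
    · have := (intervalIntegral.intervalIntegrable_rpow' (a := 0) (b := b) (r := p - 1) (by linarith)).const_mul p
      exact (intervalIntegrable_iff_integrableOn_Ioc_of_le hb).1 this
    · refine (ae_restrict_iff' measurableSet_Ioc).2 (ae_of_all _ fun t ht => ?_)
      exact mul_nonneg hp.le (Real.rpow_nonneg ht.1.le _)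
  rcases eq_or_ne a ∞ with rfl | ha
  · rw [ENNReal.top_rpow_of_pos hp]
    refine ENNReal.eq_top_of_forall_nnreal_le fun r => ?_
    -- For `a = ∞` the integral dominates the one for the finite level r^{1/p}, whose value is r,
    -- for every r.
    have hr0 : (0 : ℝ) ≤ (r : ℝ) ^ p⁻¹ := Real.rpow_nonneg r.2 _
    have h := hfin ((r : ℝ) ^ p⁻¹) hr0
    rw [ENNReal.ofReal_rpow_of_nonneg hr0 hp.le, ← Real.rpow_mul r.coe_nonneg,
      inv_mul_cancel₀ hp.ne', Real.rpow_one, ENNReal.ofReal_coe_nnreal] at h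
    rw [← h]
    refine lintegral_mono fun t => ?_
    exact indicator_le_indicator_of_subset (fun t _ => ENNReal.ofReal_lt_top) (fun _ => zero_le) t
  · have := hfin a.toReal ENNReal.toReal_nonneg
    rwa [ENNReal.ofReal_toReal ha] at this

/-- Layer-cake formula: write f(x)^p as the integral of p t^{p-1} over 0 < t < f(x) and exchange the
integrals by Tonelli. -/
theorem lintegral_rpow_eq_lintegral_Ioi_measure_lt {X : Type*} [MeasurableSpace X] {μ : Measure X}
    [SFinite μ] {f : X → ℝ≥0∞} (hf : Measurable f) {p : ℝ} (hp : 0 < p) :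
    ∫⁻ x, f x ^ p ∂μ = ∫⁻ t in Ioi (0 : ℝ),
      ENNReal.ofReal (p * t ^ (p - 1)) * μ {x | ENNReal.ofReal t < f x} := by
  simp_rw [← fun x => lintegral_Ioi_indicator_rpow (f x) hp]
  rw [lintegral_lintegral_swap]
  · refine lintegral_congr fun t => ?_
    have hms : MeasurableSet {x | ENNReal.ofReal t < f x} := measurableSet_lt measurable_const hf
    rw [← lintegral_indicator_const hms]
    rfl
  · apply Measurable.aemeasurable
    have : (Function.uncurry fun (x : X) (t : ℝ) => {t : ℝ | ENNReal.ofReal t < f x}.indicator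
        (fun t => ENNReal.ofReal (p * t ^ (p - 1))) t) =
        {z : X × ℝ | ENNReal.ofReal z.2 < f z.1}.indicator
          (fun z => ENNReal.ofReal (p * z.2 ^ (p - 1))) := rfl
    rw [this]
    refine Measurable.indicator (by fun_prop) ?_
    exact measurableSet_lt (by fun_prop) (by fun_prop)

/-- The part of `u` where |u| ≤ t has all its averages at most t. -/
theorem localFracMax_zero_le_add {n : ℕ} (u : EuclideanSpace ℝ (Fin n) → ℝ) (t : ℝ)
    (x : EuclideanSpace ℝ (Fin n)) :
    localFracMax 0 univ u x ≤
      localFracMax 0 univ ({y | t < ‖u y‖}.indicator u) x + ENNReal.ofReal t := by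
  refine iSup_le fun r => iSup_le fun hr => iSup_le fun hrx => ?_
  refine le_trans ?_ (add_le_add_left (le_localFracMax (α := 0) hr hrx) _)
  rw [ENNReal.rpow_zero, one_mul, one_mul, setLAverage_eq, setLAverage_eq]
  have h0 := (measure_ball_pos volume x hr).ne'
  have h1 : volume (ball x r) ≠ ∞ := measure_ball_lt_top.ne
  calc (∫⁻ y in ball x r, ‖u y‖ₑ) / volume (ball x r)
      ≤ (∫⁻ y in ball x r, (‖{y | t < ‖u y‖}.indicator u y‖ₑ + ENNReal.ofReal t)) /
          volume (ball x r) := by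
        gcongr with y
        by_cases hy : y ∈ {y | t < ‖u y‖}
        · rw [indicator_of_mem hy]; exact le_self_add
        · rw [indicator_of_notMem hy, ← ofReal_norm, enorm_zero, zero_add]
          exact ENNReal.ofReal_le_ofReal (not_lt.1 hy)
    _ = _ := by
        rw [lintegral_add_right _ measurable_const, setLIntegral_const, ENNReal.add_div,
          ENNReal.mul_div_cancel_right h0 h1]

/-- Marcinkiewicz interpolation: at level t only the part of `u` above t/2 matters, and the weak
(1,1) bound is applied to that part. -/
theorem lintegral_localFracMax_zero_rpow_le {n : ℕ} {u : EuclideanSpace ℝ (Fin n) → ℝ}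
    (hu : Measurable u) {p : ℝ} (hp : 1 < p) :
    ∫⁻ x, localFracMax 0 univ u x ^ p ≤
      5 ^ n * ENNReal.ofReal (2 ^ p * (p / (p - 1))) * ∫⁻ x, ‖u x‖ₑ ^ p := by
  have hp0 : 0 < p := by linarith
  have hp1 : 0 < p - 1 := by linarith
  rw [lintegral_rpow_eq_lintegral_Ioi_measure_lt (measurable_localFracMax _ _ _) hp0]
  -- Integrating in t gives (2|u|)^{p-1}|u| = 2^{p-1}|u|^p, by the layer-cake formula with exponent
  -- p-1.
  let F : ℝ → EuclideanSpace ℝ (Fin n) → ℝ≥0∞ := fun t x =>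
    {t : ℝ | ENNReal.ofReal t < 2 * ‖u x‖ₑ}.indicator
      (fun t => ENNReal.ofReal ((p - 1) * t ^ (p - 1 - 1))) t * ‖u x‖ₑ
  have hweak : ∀ t ∈ Ioi (0 : ℝ), ENNReal.ofReal (p * t ^ (p - 1)) *
      volume {x | ENNReal.ofReal t < localFracMax 0 univ u x} ≤
      5 ^ n * ENNReal.ofReal (2 * (p / (p - 1))) * ∫⁻ x, F t x := by
    intro t ht
    have ht0 : 0 < t := ht
    set v := {y | t / 2 < ‖u y‖}.indicator u with hv
    have h1 : {x | ENNReal.ofReal t < localFracMax 0 univ u x} ⊆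
        {x | ENNReal.ofReal (t / 2) < localFracMax 0 univ v x} := by
      intro x hx
      have hx' : ENNReal.ofReal t < localFracMax 0 univ u x := hx
      have h := hx'.trans_le (localFracMax_zero_le_add u (t / 2) x)
      rw [show t = t / 2 + t / 2 by ring, ENNReal.ofReal_add (by positivity) (by positivity),
        ← show t = t / 2 + t / 2 by ring] at h
      exact lt_of_add_lt_add_right h
    have h2 := mul_measure_setOf_lt_localFracMax_le v (ENNReal.ofReal (t / 2))
    have h3 : ENNReal.ofReal ((p - 1) * t ^ (p - 1 - 1)) * ∫⁻ x, ‖v x‖ₑ = ∫⁻ x, F t x := by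
      rw [← lintegral_const_mul' _ _ ENNReal.ofReal_ne_top]
      refine lintegral_congr fun x => ?_
      have hiff : (t / 2 < ‖u x‖) ↔ ENNReal.ofReal t < 2 * ‖u x‖ₑ := by
        rw [← ofReal_norm, ← ENNReal.ofReal_ofNat 2, ← ENNReal.ofReal_mul (by norm_num),
          ENNReal.ofReal_lt_ofReal_iff_of_nonneg ht0.le, div_lt_iff₀' (by norm_num)]
      by_cases hx : t / 2 < ‖u x‖
      · rw [hv, indicator_of_mem (by exact hx)]
        simp only [F]
        rw [indicator_of_mem (by exact hiff.1 hx)]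
      · rw [hv, indicator_of_notMem (by exact hx)]
        simp only [F]
        rw [indicator_of_notMem (by exact fun h => hx (hiff.2 h))]
        simp
    calc ENNReal.ofReal (p * t ^ (p - 1)) * volume {x | ENNReal.ofReal t < localFracMax 0 univ u x}
        ≤ ENNReal.ofReal (2 * (p / (p - 1)) * ((p - 1) * t ^ (p - 1 - 1)) * (t / 2)) *
          volume {x | ENNReal.ofReal (t / 2) < localFracMax 0 univ v x} := by
          -- The weight p t^{p-1} is factored so that t/2 meets the weak-type bound and (p-1)
          -- t^{p-2} remains for `F`.
          refine mul_le_mul' (le_of_eq ?_) (measure_mono h1)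
          congr 1
          rw [Real.rpow_sub_one ht0.ne' (p - 1)]
          field_simp
      _ = ENNReal.ofReal (2 * (p / (p - 1))) * ENNReal.ofReal ((p - 1) * t ^ (p - 1 - 1)) *
          (ENNReal.ofReal (t / 2) *
            volume {x | ENNReal.ofReal (t / 2) < localFracMax 0 univ v x}) := by
          rw [ENNReal.ofReal_mul (by positivity), ENNReal.ofReal_mul (by positivity), mul_assoc]
      _ ≤ ENNReal.ofReal (2 * (p / (p - 1))) * ENNReal.ofReal ((p - 1) * t ^ (p - 1 - 1)) *
          (5 ^ n * ∫⁻ x, ‖v x‖ₑ) := by gcongr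
      _ = 5 ^ n * ENNReal.ofReal (2 * (p / (p - 1))) * ∫⁻ x, F t x := by rw [← h3]; ring
  calc _ ≤ ∫⁻ t in Ioi (0 : ℝ), 5 ^ n * ENNReal.ofReal (2 * (p / (p - 1))) * ∫⁻ x, F t x :=
        setLIntegral_mono' measurableSet_Ioi hweak
    _ = 5 ^ n * ENNReal.ofReal (2 * (p / (p - 1))) * ∫⁻ x, ∫⁻ t in Ioi (0 : ℝ), F t x := by
        rw [lintegral_const_mul' _ _ (by finiteness), lintegral_lintegral_swap]
        apply Measurable.aemeasurable
        refine Measurable.mul ?_ (by fun_prop)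
        have : (fun z : ℝ × EuclideanSpace ℝ (Fin n) =>
            {t : ℝ | ENNReal.ofReal t < 2 * ‖u z.2‖ₑ}.indicator
              (fun t => ENNReal.ofReal ((p - 1) * t ^ (p - 1 - 1))) z.1) =
            {z : ℝ × EuclideanSpace ℝ (Fin n) | ENNReal.ofReal z.1 < 2 * ‖u z.2‖ₑ}.indicator
              (fun z => ENNReal.ofReal ((p - 1) * z.1 ^ (p - 1 - 1))) := rfl
        rw [this]
        exact Measurable.indicator (by fun_prop) (measurableSet_lt (by fun_prop) (by fun_prop))
    _ = 5 ^ n * ENNReal.ofReal (2 * (p / (p - 1))) *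
        ∫⁻ x, ENNReal.ofReal (2 ^ (p - 1)) * ‖u x‖ₑ ^ p := by
        congr 1
        refine lintegral_congr fun x => ?_
        simp only [F]
        rw [lintegral_mul_const' _ _ enorm_ne_top, lintegral_Ioi_indicator_rpow _ hp1,
          ENNReal.mul_rpow_of_nonneg _ _ hp1.le, mul_assoc]
        congr 1
        · rw [← ENNReal.ofReal_rpow_of_pos (by norm_num), ENNReal.ofReal_ofNat]
        · rcases eq_or_ne (‖u x‖ₑ) 0 with h | h
          · rw [h, mul_zero, ENNReal.zero_rpow_of_pos hp0]
          · nth_rw 2 [← ENNReal.rpow_one ‖u x‖ₑ]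
            rw [← ENNReal.rpow_add _ _ h enorm_ne_top, sub_add_cancel]
    _ = _ := by
        rw [lintegral_const_mul' _ _ ENNReal.ofReal_ne_top, ← mul_assoc, mul_assoc (5 ^ n),
          ← ENNReal.ofReal_mul (by positivity), Real.rpow_sub_one (by norm_num)]
        congr 3
        ring

/-! ### Fractional maximal functions of L^p functions -/

/-- Jensen's inequality, read as monotonicity of L^p norms for the normalised measure. -/
theorem laverage_rpow_le {X : Type*} [MeasurableSpace X] {μ : Measure X} [IsFiniteMeasure μ]
    [NeZero μ] {u : X → ℝ} (hu : AEStronglyMeasurable u μ) {p : ℝ} (hp : 1 ≤ p) :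
    (⨍⁻ x, ‖u x‖ₑ ∂μ) ^ p ≤ ⨍⁻ x, ‖u x‖ₑ ^ p ∂μ := by
  have hp0 : 0 < p := by linarith
  have h := eLpNorm_le_eLpNorm_of_exponent_le (μ := (μ univ)⁻¹ • μ) (f := u)
    (p := 1) (q := ENNReal.ofReal p) (by simpa using hp) (hu.smul_measure _)
  rw [eLpNorm_one_eq_lintegral_enorm, eLpNorm_eq_lintegral_rpow_enorm_toReal (by simpa using hp0)
    ENNReal.ofReal_ne_top, ENNReal.toReal_ofReal hp0.le] at h
  rw [laverage, laverage]
  calc _ ≤ _ := ENNReal.rpow_le_rpow h hp0.le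
    _ = _ := by rw [← ENNReal.rpow_mul, one_div, inv_mul_cancel₀ hp0.ne', ENNReal.rpow_one]

/-- Hedberg's trick. With A the average over a ball of radius r, r^β A = (r^n A^p)^{β/n} A^{1-βp/n}.
Jensen bounds the first factor by the L^p norm, and A ≤ M_0 u bounds the second; the exponent
np/(n-βp) makes the power of A equal to p. -/
theorem localFracMax_rpow_le {n : ℕ} {u : EuclideanSpace ℝ (Fin n) → ℝ}
    (hu : Measurable u) {p β : ℝ} (hp : 1 ≤ p) (hβ : 0 ≤ β) (hβp : β * p < n)
    (x : EuclideanSpace ℝ (Fin n)) :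
    localFracMax β univ u x ^ (n * p / (n - β * p)) ≤
      ((∫⁻ y, ‖u y‖ₑ ^ p) / volume (ball (0 : EuclideanSpace ℝ (Fin n)) 1)) ^ (β * p / (n - β * p)) *
        localFracMax 0 univ u x ^ p := by
  have hp0 : 0 < p := by linarith
  have hn : (0 : ℝ) < n := (mul_nonneg hβ hp0.le).trans_lt hβp
  have hd : 0 < n - β * p := by linarith
  have hq : 0 < n * p / (n - β * p) := by positivity
  rw [← ENNReal.le_rpow_inv_iff hq]
  refine iSup_le fun r => iSup_le fun hr => iSup_le fun hrx => ?_
  rw [ENNReal.le_rpow_inv_iff hq]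
  set A := ⨍⁻ y in ball x r, ‖u y‖ₑ ∂volume with hA
  have hA0 : A ≤ localFracMax 0 univ u x := by
    simpa [hA] using le_localFracMax (α := 0) (u := u) hr hrx
  have hAp : ENNReal.ofReal r ^ (n : ℝ) * A ^ p ≤
      (∫⁻ y, ‖u y‖ₑ ^ p) / volume (ball (0 : EuclideanSpace ℝ (Fin n)) 1) := by
    have hb : volume (ball x r) = ENNReal.ofReal r ^ (n : ℝ) *
        volume (ball (0 : EuclideanSpace ℝ (Fin n)) 1) := by
      rw [Measure.addHaar_ball_of_pos _ _ hr, finrank_euclideanSpace_fin,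
        ENNReal.ofReal_pow hr.le, ENNReal.rpow_natCast]
    have hc0 : ENNReal.ofReal r ^ (n : ℝ) ≠ 0 := by
      rw [ENNReal.rpow_natCast]; exact pow_ne_zero _ (by simpa using hr)
    have hc1 : ENNReal.ofReal r ^ (n : ℝ) ≠ ∞ := by
      rw [ENNReal.rpow_natCast]; finiteness
    have : IsFiniteMeasure (volume.restrict (ball x r)) :=
      isFiniteMeasure_restrict.2 measure_ball_lt_top.ne
    have : NeZero (volume.restrict (ball x r)) :=
      ⟨by rw [Ne, Measure.restrict_eq_zero]; exact (measure_ball_pos _ _ hr).ne'⟩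
    calc ENNReal.ofReal r ^ (n : ℝ) * A ^ p
        ≤ ENNReal.ofReal r ^ (n : ℝ) * ((∫⁻ y in ball x r, ‖u y‖ₑ ^ p) / volume (ball x r)) := by
          rw [← setLAverage_eq]
          gcongr
          exact laverage_rpow_le hu.aestronglyMeasurable hp
      _ ≤ ENNReal.ofReal r ^ (n : ℝ) * ((∫⁻ y, ‖u y‖ₑ ^ p) / volume (ball x r)) := by
          gcongr
          exact Measure.restrict_le_self
      _ = _ := by rw [hb, ← mul_div_assoc, ENNReal.mul_div_mul_left _ _ hc0 hc1]
  have e1 : ENNReal.ofReal r ^ β * A = (ENNReal.ofReal r ^ (n : ℝ) * A ^ p) ^ (β / n) *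
      A ^ (1 - β * p / n) := by
    rw [ENNReal.mul_rpow_of_nonneg _ _ (by positivity), ← ENNReal.rpow_mul, ← ENNReal.rpow_mul,
      mul_assoc, ← ENNReal.rpow_add_of_nonneg]
    · rw [mul_div_cancel₀ _ hn.ne', show p * (β / n) + (1 - β * p / n) = 1 by ring, ENNReal.rpow_one]
    · positivity
    · rw [sub_nonneg, div_le_one hn]; exact hβp.le
  rw [e1, ENNReal.mul_rpow_of_nonneg _ _ hq.le, ← ENNReal.rpow_mul, ← ENNReal.rpow_mul]
  have e2 : β / n * (n * p / (n - β * p)) = β * p / (n - β * p) := by field_simp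
  have e3 : (1 - β * p / n) * (n * p / (n - β * p)) = p := by field_simp
  rw [e2, e3]
  gcongr

/-- Hedberg's inequality is integrated and combined with the strong (p,p) bound, after `u` is
replaced by a measurable representative extended by zero; this alters no average over an admissible
ball. -/
theorem lintegral_localFracMax_rpow_lt_top {n : ℕ} {u : EuclideanSpace ℝ (Fin n) → ℝ}
    {Ω : Set (EuclideanSpace ℝ (Fin n))} (hΩ : MeasurableSet Ω)
    {p β : ℝ} (hp : 1 < p) (hu : MemLp u (ENNReal.ofReal p) (volume.restrict Ω))
    (hβ : 0 ≤ β) (hβp : β * p < n) :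
    ∫⁻ x, localFracMax β Ω u x ^ (n * p / (n - β * p)) < ∞ := by
  have hp0 : 0 < p := by linarith
  obtain ⟨v, hv, huv⟩ := hu.1.aemeasurable
  set w := Ω.indicator v with hw
  have hwm : Measurable w := hv.indicator hΩ
  have huw : ∀ᵐ x ∂(volume.restrict Ω), u x = w x := by
    filter_upwards [huv, ae_restrict_mem hΩ] with x hx hxΩ
    rw [hx, hw, indicator_of_mem hxΩ]
  have hfin : ∫⁻ y, ‖w y‖ₑ ^ p < ∞ := by
    have h := lintegral_rpow_enorm_lt_top_of_eLpNorm_lt_top (by simpa using hp0)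
      ENNReal.ofReal_ne_top hu.2
    rw [ENNReal.toReal_ofReal hp0.le] at h
    have e : ∀ y, ‖w y‖ₑ ^ p = Ω.indicator (fun y => ‖w y‖ₑ ^ p) y := by
      intro y
      by_cases hy : y ∈ Ω
      · rw [indicator_of_mem hy]
      · rw [indicator_of_notMem hy, hw, indicator_of_notMem hy, enorm_zero,
          ENNReal.zero_rpow_of_pos hp0]
    rw [lintegral_congr e, lintegral_indicator hΩ]
    refine lt_of_eq_of_lt (lintegral_congr_ae ?_) h
    filter_upwards [huw] with x hx
    rw [hx]
  have hd : 0 < n - β * p := by linarith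
  rw [localFracMax_congr (v := w) (huw.mono fun x hx => by rw [hx])]
  calc ∫⁻ x, localFracMax β Ω w x ^ (n * p / (n - β * p))
      ≤ ∫⁻ x, localFracMax β univ w x ^ (n * p / (n - β * p)) := by
        gcongr with x
        exact localFracMax_mono_set (subset_univ _) _ _
    _ ≤ ∫⁻ x, ((∫⁻ y, ‖w y‖ₑ ^ p) / volume (ball (0 : EuclideanSpace ℝ (Fin n)) 1)) ^
          (β * p / (n - β * p)) * localFracMax 0 univ w x ^ p :=
        lintegral_mono fun x => localFracMax_rpow_le hwm hp.le hβ hβp x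
    _ = ((∫⁻ y, ‖w y‖ₑ ^ p) / volume (ball (0 : EuclideanSpace ℝ (Fin n)) 1)) ^
          (β * p / (n - β * p)) * ∫⁻ x, localFracMax 0 univ w x ^ p :=
        lintegral_const_mul _ ((measurable_localFracMax _ _ _).pow_const _)
    _ < ∞ := by
        refine ENNReal.mul_lt_top ?_ ?_
        · refine ENNReal.rpow_lt_top_of_nonneg (by positivity) ?_
          exact ENNReal.div_ne_top hfin.ne (measure_ball_pos _ _ one_pos).ne'
        · refine (lintegral_localFracMax_zero_rpow_le hwm hp).trans_lt ?_
          exact ENNReal.mul_lt_top (by finiteness) hfin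

/-- On a set of finite measure, a power of a function is integrable if a higher power is. -/
theorem lintegral_rpow_lt_top_of_le {X : Type*} [MeasurableSpace X] {μ : Measure X}
    [IsFiniteMeasure μ] {f : X → ℝ≥0∞} {q s : ℝ} (hq : 0 ≤ q) (hqs : q ≤ s)
    (hf : ∫⁻ x, f x ^ s ∂μ < ∞) : ∫⁻ x, f x ^ q ∂μ < ∞ := by
  refine lt_of_le_of_lt (lintegral_mono (g := fun x => 1 + f x ^ s) fun x => ?_) ?_
  · rcases le_total (f x) 1 with h | h
    · exact (ENNReal.rpow_le_one h hq).trans le_self_add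
    · exact (ENNReal.rpow_le_rpow_of_exponent_le h hqs).trans le_add_self
  · rw [lintegral_add_left measurable_const, lintegral_const]
    finiteness

/-! ### Weak gradients tested in arbitrary directions -/

theorem MeasureTheory.LocallyIntegrableOn.integrable_smul_of_tsupport_subset {X F : Type*}
    [TopologicalSpace X] [T2Space X] [SecondCountableTopology X] [MeasurableSpace X]
    [OpensMeasurableSpace X]
    [NormedAddCommGroup F] [NormedSpace ℝ F] {μ : Measure X} {Ω : Set X}
    {f : X → F} (hf : LocallyIntegrableOn f Ω μ) {φ : X → ℝ} (hφ : Continuous φ)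
    (hφc : HasCompactSupport φ) (hφΩ : tsupport φ ⊆ Ω) : Integrable (fun x => φ x • f x) μ := by
  have h1 : IntegrableOn f (tsupport φ) μ := hf.integrableOn_compact_subset hφΩ hφc
  have h2 : IntegrableOn (fun x => φ x • f x) (tsupport φ) μ :=
    h1.continuousOn_smul hφ.continuousOn hφc
  refine (integrableOn_iff_integrable_of_support_subset ?_).1 h2
  exact (Function.support_smul_subset_left φ f).trans (subset_tsupport φ)

theorem HasWeakGradient.integral_mul_fderiv {n : ℕ} {Ω : Set (EuclideanSpace ℝ (Fin n))}
    {u : EuclideanSpace ℝ (Fin n) → ℝ} {g : EuclideanSpace ℝ (Fin n) → EuclideanSpace ℝ (Fin n)}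
    (h : HasWeakGradient Ω u g) {φ : EuclideanSpace ℝ (Fin n) → ℝ}
    (hφ : ContDiff ℝ ((⊤ : ℕ∞) : WithTop ℕ∞) φ)
    (hφc : HasCompactSupport φ) (hφΩ : tsupport φ ⊆ Ω) (e : EuclideanSpace ℝ (Fin n)) :
    ∫ x in Ω, u x * fderiv ℝ φ x e = - ∫ x in Ω, φ x * inner ℝ (g x) e := by
  obtain ⟨hu, hg, hug⟩ := h
  have he : e = ∑ i, e i • EuclideanSpace.single i (1 : ℝ) := by
    have := (EuclideanSpace.basisFun (Fin n) ℝ).sum_repr e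
    simpa using this.symm
  have hd : ∀ v : EuclideanSpace ℝ (Fin n), Continuous fun x => fderiv ℝ φ x v := fun v =>
    (hφ.continuous_fderiv (by simp)).clm_apply continuous_const
  have h1 : ∀ i, Integrable (fun x => e i * (u x * fderiv ℝ φ x (EuclideanSpace.single i 1)))
      (volume.restrict Ω) := by
    intro i
    refine Integrable.const_mul ?_ _
    have hc : HasCompactSupport fun x => fderiv ℝ φ x (EuclideanSpace.single i 1) :=
      hφc.fderiv_apply (𝕜 := ℝ) _
    have := hu.integrable_smul_of_tsupport_subset (hd _) hc
      ((tsupport_fderiv_apply_subset ℝ _).trans hφΩ)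
    simpa [mul_comm] using this.restrict (s := Ω)
  have h2 : ∀ i, Integrable (fun x => e i * (g x i * φ x)) (volume.restrict Ω) := by
    intro i
    refine Integrable.const_mul ?_ _
    have := (hg.integrable_smul_of_tsupport_subset hφ.continuous hφc hφΩ).restrict (s := Ω)
    have h3 := (EuclideanSpace.proj (𝕜 := ℝ) i : EuclideanSpace ℝ (Fin n) →L[ℝ] ℝ).integrable_comp this
    simpa [mul_comm] using h3
  have e1 : ∀ x, u x * fderiv ℝ φ x e =
      ∑ i, e i * (u x * fderiv ℝ φ x (EuclideanSpace.single i 1)) := by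
    intro x
    conv_lhs => rw [he, map_sum, Finset.mul_sum]
    refine Finset.sum_congr rfl fun i _ => ?_
    rw [map_smul, smul_eq_mul]
    ring
  have e2 : ∀ x, φ x * inner ℝ (g x) e = ∑ i, e i * (g x i * φ x) := by
    intro x
    rw [PiLp.inner_apply, Finset.mul_sum]
    refine Finset.sum_congr rfl fun i _ => ?_
    simp
    ring
  simp_rw [e1, e2]
  rw [integral_finsetSum _ fun i _ => h1 i, integral_finsetSum _ fun i _ => h2 i,
    ← Finset.sum_neg_distrib]
  refine Finset.sum_congr rfl fun i _ => ?_
  rw [integral_const_mul, integral_const_mul, hug φ hφ hφc hφΩ i, mul_neg]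

/-! ### Averages over balls with varying centre and radius -/

/-- Pulling balls back to the unit ball lets averages with different centres and radii be compared
pointwise in y. -/
theorem setLAverage_ball_eq {n : ℕ} (f : EuclideanSpace ℝ (Fin n) → ℝ≥0∞)
    (x : EuclideanSpace ℝ (Fin n)) {r : ℝ} (hr : 0 < r) :
    ⨍⁻ y in ball x r, f y ∂volume =
      ⨍⁻ y in ball (0 : EuclideanSpace ℝ (Fin n)) 1, f (x + r • y) ∂volume := by
  let T : EuclideanSpace ℝ (Fin n) → EuclideanSpace ℝ (Fin n) := fun y => x + r • y
  have hT : MeasurableEmbedding T :=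
    (MeasurableEquiv.addLeft x).measurableEmbedding.comp
      (Homeomorph.smulOfNeZero r hr.ne').measurableEmbedding
  have hpre : T ⁻¹' ball x r = ball 0 1 := by
    ext y
    simp [T, norm_smul, abs_of_pos hr, mul_lt_iff_lt_one_right hr]
  have hmap : Measure.map T volume = ENNReal.ofReal (r ^ n)⁻¹ • volume := by
    have : T = (fun y => x + y) ∘ (r • ·) := rfl
    rw [this, ← Measure.map_map (measurable_const_add x) (measurable_const_smul r),
      Measure.map_addHaar_smul _ hr.ne', Measure.map_smul, map_add_left_eq_self,
      finrank_euclideanSpace_fin, abs_of_pos (by positivity)]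
  have h1 : ∫⁻ y in ball (0 : EuclideanSpace ℝ (Fin n)) 1, f (x + r • y) =
      ENNReal.ofReal (r ^ n)⁻¹ * ∫⁻ y in ball x r, f y := by
    rw [← hpre]
    change ∫⁻ y in T ⁻¹' ball x r, f (T y) = _
    rw [← hT.lintegral_map, ← hT.restrict_map, hmap, Measure.restrict_smul, lintegral_smul_measure,
      smul_eq_mul]
  have hrn : (0 : ℝ) < r ^ n := by positivity
  rw [setLAverage_eq, setLAverage_eq, h1, Measure.addHaar_ball_of_pos _ _ hr,
    finrank_euclideanSpace_fin, ENNReal.ofReal_inv_of_pos hrn, ENNReal.div_eq_inv_mul,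
    ENNReal.div_eq_inv_mul, ENNReal.mul_inv (Or.inl (by simpa using hrn)) (Or.inl ENNReal.ofReal_ne_top)]
  ring

/-- Dominated convergence: the indicators of the balls converge off the limiting sphere, which is
null, and `f` on the larger ball dominates. -/
theorem continuousAt_setLAverage_ball {n : ℕ} {f : EuclideanSpace ℝ (Fin n) → ℝ≥0∞}
    (hf : Measurable f) {x : EuclideanSpace ℝ (Fin n)} {r R : ℝ} (hr : 0 < r) (hrR : r < R)
    (hfin : ∫⁻ y in ball x R, f y < ∞) :
    ContinuousAt (fun z : EuclideanSpace ℝ (Fin n) × ℝ => ⨍⁻ y in ball z.1 z.2, f y ∂volume)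
      (x, r) := by
  have hnum : ContinuousAt (fun z : EuclideanSpace ℝ (Fin n) × ℝ => ∫⁻ y in ball z.1 z.2, f y)
      (x, r) := by
    simp_rw [← lintegral_indicator (measurableSet_ball) f]
    refine tendsto_lintegral_filter_of_dominated_convergence ((ball x R).indicator f)
      (Eventually.of_forall fun z => hf.indicator measurableSet_ball) ?_
      (by rw [lintegral_indicator measurableSet_ball]; exact hfin.ne) ?_
    · have h : ∀ᶠ z : EuclideanSpace ℝ (Fin n) × ℝ in 𝓝 (x, r), z.2 + dist z.1 x < R :=
        (show Continuous fun z : EuclideanSpace ℝ (Fin n) × ℝ => z.2 + dist z.1 x by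
          fun_prop).continuousAt.eventually (gt_mem_nhds (by simpa using hrR))
      filter_upwards [h] with z hz
      refine ae_of_all _ fun y => indicator_le_indicator_of_subset ?_ (fun _ => zero_le) y
      exact ball_subset_ball' hz.le
    · have hs : ∀ᵐ y : EuclideanSpace ℝ (Fin n), y ∉ sphere x r :=
        measure_eq_zero_iff_ae_notMem.1 (Measure.addHaar_sphere_of_ne_zero _ _ hr.ne')
      filter_upwards [hs] with y hy
      rw [mem_sphere] at hy
      have hc : Continuous fun z : EuclideanSpace ℝ (Fin n) × ℝ => dist y z.1 - z.2 := by fun_prop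
      rcases lt_or_gt_of_ne hy with h | h
      · have h' : ∀ᶠ z in 𝓝 (x, r), dist y z.1 - z.2 < 0 :=
          hc.continuousAt.eventually (gt_mem_nhds (by simpa using h))
        refine tendsto_const_nhds.congr' ?_
        filter_upwards [h'] with z hz
        rw [indicator_of_mem (mem_ball.2 h), indicator_of_mem (mem_ball.2 (by linarith))]
      · have h' : ∀ᶠ z in 𝓝 (x, r), 0 < dist y z.1 - z.2 :=
          hc.continuousAt.eventually (lt_mem_nhds (by simpa using h))
        refine tendsto_const_nhds.congr' ?_
        filter_upwards [h'] with z hz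
        rw [indicator_of_notMem (by simpa using h.le),
          indicator_of_notMem (by rw [mem_ball]; linarith)]
  have hden : ContinuousAt (fun z : EuclideanSpace ℝ (Fin n) × ℝ => volume (ball z.1 z.2))
      (x, r) := by
    have hpos : ∀ᶠ z : EuclideanSpace ℝ (Fin n) × ℝ in 𝓝 (x, r), 0 < z.2 :=
      continuous_snd.continuousAt.eventually (lt_mem_nhds hr)
    have : ContinuousAt (fun z : EuclideanSpace ℝ (Fin n) × ℝ => ENNReal.ofReal (z.2 ^ n) *
        volume (ball (0 : EuclideanSpace ℝ (Fin n)) 1)) (x, r) := by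
      refine ENNReal.Tendsto.mul_const ?_ (Or.inr measure_ball_lt_top.ne)
      exact (ENNReal.continuous_ofReal.comp (continuous_snd.pow n)).continuousAt
    refine this.congr ?_
    filter_upwards [hpos] with z hz
    rw [Measure.addHaar_ball_of_pos _ _ hz, finrank_euclideanSpace_fin]
  simp_rw [setLAverage_eq]
  exact ENNReal.Tendsto.div hnum (Or.inr (measure_ball_pos _ _ hr).ne') hden
    (Or.inl measure_ball_lt_top.ne)

/-! ### Mollification and the mean Lipschitz estimate for Sobolev functions -/

theorem ContDiffBump.support_normed_sub_subset {n : ℕ}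
    (φ : ContDiffBump (0 : EuclideanSpace ℝ (Fin n))) (z : EuclideanSpace ℝ (Fin n)) :
    Function.support (fun t => φ.normed volume (z - t)) ⊆ closedBall z φ.rOut := by
  intro t ht
  have h : z - t ∈ Function.support (φ.normed volume) := ht
  rw [φ.support_normed_eq, mem_ball_zero_iff] at h
  rw [mem_closedBall, dist_comm, dist_eq_norm]
  exact h.le

theorem ContDiffBump.tsupport_normed_sub_subset {n : ℕ}
    (φ : ContDiffBump (0 : EuclideanSpace ℝ (Fin n))) (z : EuclideanSpace ℝ (Fin n)) :
    tsupport (fun t => φ.normed volume (z - t)) ⊆ closedBall z φ.rOut :=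
  closure_minimal (φ.support_normed_sub_subset z) isClosed_closedBall

theorem ContDiffBump.hasCompactSupport_normed_sub {n : ℕ}
    (φ : ContDiffBump (0 : EuclideanSpace ℝ (Fin n))) (z : EuclideanSpace ℝ (Fin n)) :
    HasCompactSupport (fun t => φ.normed volume (z - t)) :=
  HasCompactSupport.of_support_subset_isCompact (isCompact_closedBall _ _)
    (φ.support_normed_sub_subset z)

theorem ContDiffBump.contDiff_normed_sub {n : ℕ}
    (φ : ContDiffBump (0 : EuclideanSpace ℝ (Fin n))) (z : EuclideanSpace ℝ (Fin n)) :
    ContDiff ℝ ((⊤ : ℕ∞) : WithTop ℕ∞) (fun t => φ.normed volume (z - t)) :=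
  φ.contDiff_normed.comp (contDiff_const.sub contDiff_id)

/-- The derivative of a mollification is the mollified weak gradient, because t ↦ φ(z-t) is a test
function supported in `S`. Cutting `u` off outside `S` makes the convolution meaningful on the whole
space without affecting it near z. -/
theorem HasWeakGradient.enorm_fderiv_convolution_le {n : ℕ} {Ω S : Set (EuclideanSpace ℝ (Fin n))}
    {u : EuclideanSpace ℝ (Fin n) → ℝ} {g : EuclideanSpace ℝ (Fin n) → EuclideanSpace ℝ (Fin n)}
    (h : HasWeakGradient Ω u g) (hΩ : MeasurableSet Ω) (hS : S ⊆ Ω)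
    (hu : LocallyIntegrable (S.indicator u))
    (φ : ContDiffBump (0 : EuclideanSpace ℝ (Fin n))) {z : EuclideanSpace ℝ (Fin n)}
    (hz : closedBall z φ.rOut ⊆ S) :
    ‖fderiv ℝ (φ.normed volume ⋆[lsmul ℝ ℝ, volume] S.indicator u) z‖ₑ ≤
      ∫⁻ t, ENNReal.ofReal (φ.normed volume t) * ‖g (z - t)‖ₑ := by
  set f := φ.normed (volume : Measure (EuclideanSpace ℝ (Fin n))) with hf
  have hfs : ContDiff ℝ ((⊤ : ℕ∞) : WithTop ℕ∞) f := φ.contDiff_normed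
  have hf1 : ContDiff ℝ 1 f := hfs.of_le (by exact_mod_cast le_top)
  have hfc : HasCompactSupport f := φ.hasCompactSupport_normed
  have hnn : ∀ t, 0 ≤ f t := φ.nonneg_normed
  set ψ : EuclideanSpace ℝ (Fin n) → ℝ := fun t => f (z - t) with hψ
  have hψs := φ.contDiff_normed_sub z
  have hψc := φ.hasCompactSupport_normed_sub z
  have hψt := φ.tsupport_normed_sub_subset z
  have hψΩ : tsupport ψ ⊆ Ω := hψt.trans (hz.trans hS)
  -- This sign cancels the one in the definition of the weak gradient.
  have hψd : ∀ t e, fderiv ℝ ψ t e = - fderiv ℝ f (z - t) e := by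
    intro t e
    have h1 : HasFDerivAt f (fderiv ℝ f (z - t)) (z - t) :=
      (hf1.differentiable one_ne_zero _).hasFDerivAt
    have h2 : HasFDerivAt ψ _ t := h1.comp t ((hasFDerivAt_id t).const_sub z)
    rw [h2.fderiv]
    simp
  have hderiv : ∀ e, fderiv ℝ (f ⋆[lsmul ℝ ℝ, volume] S.indicator u) z e =
      ∫ t in Ω, ψ t * inner ℝ (g t) e := by
    intro e
    have h1 := (hfc.hasFDerivAt_convolution_right (lsmul ℝ ℝ).flip hu hf1 z).fderiv
    rw [convolution_flip] at h1
    rw [h1, convolution_precompR_apply _ hu (hfc.fderiv ℝ) (hf1.continuous_fderiv one_ne_zero),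
      convolution_def]
    have h2 := h.integral_mul_fderiv hψs hψc hψΩ e
    rw [← neg_eq_iff_eq_neg, ← integral_neg] at h2
    rw [← h2, ← integral_indicator hΩ]
    refine integral_congr_ae (ae_of_all _ fun t => ?_)
    simp only [ContinuousLinearMap.flip_apply, ContinuousLinearMap.lsmul_apply, smul_eq_mul]
    by_cases ht : t ∈ S
    · rw [indicator_of_mem ht, indicator_of_mem (hS ht)]
      rw [show fderiv ℝ (fun t => φ.normed volume (z - t)) t e = - fderiv ℝ f (z - t) e from hψd t e]
      ring
    · have h0 : fderiv ℝ ψ t = 0 :=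
        image_eq_zero_of_notMem_tsupport fun h' => ht (hz (hψt (tsupport_fderiv_subset ℝ h')))
      have h0' : fderiv ℝ f (z - t) e = 0 := by
        rw [← neg_eq_zero, ← hψd, h0, zero_apply]
      rw [h0', zero_mul]
      by_cases htΩ : t ∈ Ω
      · rw [indicator_of_mem htΩ, show fderiv ℝ (fun t => φ.normed volume (z - t)) t = 0 from h0]
        simp
      · rw [indicator_of_notMem htΩ]
  have hint : Integrable (fun t => ψ t * ‖g t‖) (volume.restrict Ω) :=
    (h.2.1.norm.integrable_smul_of_tsupport_subset hψs.continuous hψc hψΩ).restrict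
  have hbound : ‖fderiv ℝ (f ⋆[lsmul ℝ ℝ, volume] S.indicator u) z‖ ≤ ∫ t in Ω, ψ t * ‖g t‖ := by
    refine ContinuousLinearMap.opNorm_le_bound _
      (integral_nonneg fun t => mul_nonneg (hnn _) (norm_nonneg _)) fun e => ?_
    rw [hderiv, ← integral_mul_const]
    refine norm_integral_le_of_norm_le (hint.mul_const _) (ae_of_all _ fun t => ?_)
    rw [norm_mul, Real.norm_of_nonneg (hnn _), mul_assoc]
    exact mul_le_mul_of_nonneg_left (norm_inner_le_norm _ _) (hnn _)
  calc ‖fderiv ℝ (f ⋆[lsmul ℝ ℝ, volume] S.indicator u) z‖ₑ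
      ≤ ENNReal.ofReal (∫ t in Ω, ψ t * ‖g t‖) := by
        rw [← ofReal_norm]; exact ENNReal.ofReal_le_ofReal hbound
    _ = ∫⁻ t in Ω, ENNReal.ofReal (ψ t) * ‖g t‖ₑ := by
        rw [ofReal_integral_eq_lintegral_ofReal hint
          (ae_of_all _ fun t => mul_nonneg (hnn _) (norm_nonneg _))]
        refine lintegral_congr fun t => ?_
        rw [ENNReal.ofReal_mul (hnn _), ofReal_norm]
    _ ≤ ∫⁻ t, ENNReal.ofReal (ψ t) * ‖g t‖ₑ := setLIntegral_le_lintegral _ _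
    _ = _ := by
        rw [← lintegral_sub_left_eq_self _ z]
        simp [hψ]

/-- The shrinking bump functions used for mollification. -/
theorem exists_seq_contDiffBump (n : ℕ) {ρ : ℝ} (hρ : 0 < ρ) :
    ∃ φ : ℕ → ContDiffBump (0 : EuclideanSpace ℝ (Fin n)), (∀ k, (φ k).rOut < ρ) ∧
      Tendsto (fun k => (φ k).rOut) atTop (𝓝 0) ∧ ∀ k, (φ k).rOut ≤ 2 * (φ k).rIn := by
  -- The shift by 2 gives outer radii strictly below ρ already at k = 0; the fixed ratio 2 is what
  -- almost everywhere convergence of the mollifications requires.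
  refine ⟨fun k => ⟨ρ / (2 * (k + 2)), ρ / (k + 2), by positivity, by gcongr; linarith⟩, ?_, ?_, ?_⟩
  · intro k
    change ρ / (k + 2) < ρ
    rw [div_lt_iff₀ (by positivity)]
    nlinarith [hρ, (Nat.cast_nonneg k : (0 : ℝ) ≤ k)]
  · have : Tendsto (fun k : ℕ => ρ / ((k : ℝ) + 2)) atTop (𝓝 0) :=
      Tendsto.div_atTop tendsto_const_nhds
        (tendsto_atTop_add_const_right _ _ tendsto_natCast_atTop_atTop)
    exact this
  · intro k
    change ρ / (k + 2) ≤ 2 * (ρ / (2 * (k + 2)))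
    apply le_of_eq
    field_simp

/-- Local Lipschitz estimate, in mean, for a Sobolev function on balls with varying centre and
radius. -/
theorem HasWeakGradient.eventually_setLAverage_enorm_sub_le {n : ℕ}
    {Ω : Set (EuclideanSpace ℝ (Fin n))} (hΩ : IsOpen Ω)
    {u : EuclideanSpace ℝ (Fin n) → ℝ} {g : EuclideanSpace ℝ (Fin n) → EuclideanSpace ℝ (Fin n)}
    (h : HasWeakGradient Ω u g) (hgm : Measurable g)
    {x : EuclideanSpace ℝ (Fin n)} {r : ℝ} (hr : 0 < r) (hx : closedBall x r ⊆ Ω) {c : ℝ≥0∞}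
    (hc : ⨍⁻ y in ball x r, ‖g y‖ₑ ∂volume < c) :
    ∀ᶠ z : EuclideanSpace ℝ (Fin n) × ℝ in 𝓝 (x, r),
      ⨍⁻ y in ball (0 : EuclideanSpace ℝ (Fin n)) 1, ‖u (z.1 + z.2 • y) - u (x + r • y)‖ₑ ∂volume ≤
        c * ENNReal.ofReal (‖z.1 - x‖ + |z.2 - r|) := by
  obtain ⟨δ, hδ, hδΩ⟩ := (isCompact_closedBall x r).exists_cthickening_subset_open hΩ hx
  rw [cthickening_closedBall hδ.le hr.le] at hδΩ
  set R := δ + r with hR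
  set S := closedBall x R with hS
  have hintS : ∀ {F : Type} [NormedAddCommGroup F] {f : EuclideanSpace ℝ (Fin n) → F},
      LocallyIntegrableOn f Ω → IntegrableOn f S := fun hf =>
    hf.integrableOn_compact_subset hδΩ (isCompact_closedBall _ _)
  have huS : Integrable (S.indicator u) :=
    (integrable_indicator_iff measurableSet_closedBall).2 (hintS h.1)
  have hgfin : ∫⁻ y in ball x R, ‖g y‖ₑ < ∞ :=
    (lintegral_mono_set ball_subset_closedBall).trans_lt (hintS h.2.1).2
  have hcont := continuousAt_setLAverage_ball hgm.enorm hr (by linarith : r < R) hgfin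
  obtain ⟨η₀, hη₀, hη₀c⟩ := Metric.eventually_nhds_iff.1 (hcont.eventually (gt_mem_nhds hc))
  -- The three bounds serve, in order, to keep averages of |g| below c for centres and radii moved
  -- by less than 2η, to keep all mollified points in `S`, and to keep radii positive.
  obtain ⟨η, hη, hη1, hη2, hη3⟩ : ∃ η : ℝ, 0 < η ∧ 2 * η ≤ η₀ ∧ 4 * η ≤ δ ∧ 2 * η ≤ r :=
    ⟨min (η₀ / 2) (min (δ / 4) (r / 2)), by positivity,
      by linarith [min_le_left (η₀ / 2) (min (δ / 4) (r / 2))],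
      by linarith [min_le_right (η₀ / 2) (min (δ / 4) (r / 2)), min_le_left (δ / 4) (r / 2)],
      by linarith [min_le_right (η₀ / 2) (min (δ / 4) (r / 2)), min_le_right (δ / 4) (r / 2)]⟩
  have havg : ∀ (z : EuclideanSpace ℝ (Fin n)) (s : ℝ), dist z x < 2 * η → |s - r| < 2 * η →
      ⨍⁻ y in ball (0 : EuclideanSpace ℝ (Fin n)) 1, ‖g (z + s • y)‖ₑ ∂volume ≤ c := by
    intro z s hz hs
    have hs0 : 0 < s := by linarith [(abs_lt.1 hs).1]
    rw [← setLAverage_ball_eq (fun y => ‖g y‖ₑ) z hs0]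
    refine (@hη₀c (z, s) ?_).le
    rw [Prod.dist_eq, max_lt_iff, Real.dist_eq]
    exact ⟨hz.trans_le hη1, hs.trans_le hη1⟩
  filter_upwards [Metric.ball_mem_nhds (x, r) hη] with z hz
  rw [mem_ball, Prod.dist_eq, max_lt_iff, Real.dist_eq] at hz
  obtain ⟨hz1, hz2⟩ := hz
  set ρ := ‖z.1 - x‖ + |z.2 - r| with hρ
  obtain ⟨φ, hrout, hφlim, hφ3⟩ := exists_seq_contDiffBump n hη
  let w : ℕ → EuclideanSpace ℝ (Fin n) → ℝ := fun k =>
    (φ k).normed volume ⋆[lsmul ℝ ℝ, volume] S.indicator u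
  -- Normalised Lebesgue measure on the unit ball, so that averages are by definition integrals
  -- against `ν`.
  let ν : Measure (EuclideanSpace ℝ (Fin n)) :=
    (volume.restrict (ball (0 : EuclideanSpace ℝ (Fin n)) 1) univ)⁻¹ •
      volume.restrict (ball (0 : EuclideanSpace ℝ (Fin n)) 1)
  have hνac : ν ≪ volume :=
    Measure.smul_absolutelyContinuous.trans Measure.restrict_le_self.absolutelyContinuous
  have hνb : ∀ᵐ y ∂ν, ‖y‖ < 1 := by
    refine Measure.smul_absolutelyContinuous.ae_le ?_
    filter_upwards [ae_restrict_mem measurableSet_ball] with y hy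
    simpa using hy
  have hae : ∀ᵐ y : EuclideanSpace ℝ (Fin n), Tendsto (fun k => w k y) atTop (𝓝 (S.indicator u y)) :=
    ContDiffBump.ae_convolution_tendsto_right_of_locallyIntegrable (K := 2) hφlim
      (Eventually.of_forall hφ3) huS.locallyIntegrable
  have hwlim : ∀ (p : EuclideanSpace ℝ (Fin n)) (s : ℝ), dist p x < η → |s - r| < η →
      ∀ᵐ y ∂ν, Tendsto (fun k => w k (p + s • y)) atTop (𝓝 (u (p + s • y))) := by
    intro p s hp hs
    have hs0 : 0 < s := by linarith [(abs_lt.1 hs).1]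
    have hq : Measure.QuasiMeasurePreserving
        (fun y : EuclideanSpace ℝ (Fin n) => p + s • y) volume volume :=
      (measurePreserving_add_left volume p).quasiMeasurePreserving.comp
        (Measure.quasiMeasurePreserving_smul volume hs0.ne')
    filter_upwards [hνac.ae_le (hq.ae hae), hνb] with y hy hyb
    rwa [indicator_of_mem] at hy
    rw [hS, mem_closedBall]
    calc dist (p + s • y) x ≤ dist (p + s • y) p + dist p x := dist_triangle _ _ _
      _ ≤ s + η := by
        rw [dist_self_add_left, norm_smul, Real.norm_of_nonneg hs0.le]
        nlinarith
      _ ≤ R := by linarith [(abs_lt.1 hs).2]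
  have hwsmooth : ∀ k, ContDiff ℝ 1 (w k) := fun k =>
    (φ k).hasCompactSupport_normed.contDiff_convolution_left _ (φ k).contDiff_normed
      huS.locallyIntegrable
  -- Fundamental theorem of calculus for the smooth `w k` on the segment from x + r y to z.1 + z.2
  -- y, whose length is at most ρ since |y| < 1.
  have hline : ∀ k y, ‖y‖ < 1 → ‖w k (z.1 + z.2 • y) - w k (x + r • y)‖ₑ ≤
      ∫⁻ θ in Icc (0 : ℝ) 1, (∫⁻ t, ENNReal.ofReal ((φ k).normed volume t) *
        ‖g ((x + θ • (z.1 - x) - t) + (r + θ * (z.2 - r)) • y)‖ₑ) * ENNReal.ofReal ρ := by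
    intro k y hy
    set γ : ℝ → EuclideanSpace ℝ (Fin n) := fun θ =>
      (x + r • y) + θ • ((z.1 - x) + (z.2 - r) • y) with hγ
    have hγd : ∀ θ, HasDerivAt γ ((z.1 - x) + (z.2 - r) • y) θ := by
      intro θ
      have := ((hasDerivAt_id θ).smul_const ((z.1 - x) + (z.2 - r) • y)).const_add (x + r • y)
      simpa only [id, one_smul] using this
    have hγs : ContDiff ℝ 1 γ := by
      rw [hγ]; fun_prop
    have h01 := enorm_sub_le_lintegral_deriv_of_contDiffOn_Icc (f := fun θ => w k (γ θ))
      ((hwsmooth k).comp hγs).contDiffOn zero_le_one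
    have e1 : γ 1 = z.1 + z.2 • y := by simp only [hγ]; module
    have e0 : γ 0 = x + r • y := by simp only [hγ]; module
    simp only [e1, e0] at h01
    refine h01.trans (setLIntegral_mono' measurableSet_Icc fun θ hθ => ?_)
    have hd : deriv (fun θ => w k (γ θ)) θ = fderiv ℝ (w k) (γ θ) ((z.1 - x) + (z.2 - r) • y) :=
      (((hwsmooth k).differentiable one_ne_zero _).hasFDerivAt.comp_hasDerivAt θ (hγd θ)).deriv
    have hsub : closedBall (γ θ) (φ k).rOut ⊆ S := by
      refine closedBall_subset_closedBall' ?_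
      have h1 : dist (γ θ) x ≤ r + 2 * η := by
        rw [dist_eq_norm, show γ θ - x = θ • (z.1 - x) + (r + θ * (z.2 - r)) • y by
          simp only [hγ]; module]
        have ha : ‖θ • (z.1 - x)‖ ≤ η := by
          rw [norm_smul, Real.norm_of_nonneg hθ.1, ← dist_eq_norm]
          nlinarith [hθ.2, hθ.1, dist_nonneg (x := z.1) (y := x)]
        have hb : ‖(r + θ * (z.2 - r)) • y‖ ≤ r + η := by
          rw [norm_smul, Real.norm_eq_abs]
          have : |r + θ * (z.2 - r)| ≤ r + η := by
            calc |r + θ * (z.2 - r)| ≤ |r| + |θ * (z.2 - r)| := abs_add_le _ _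
              _ ≤ r + η := by
                rw [abs_of_pos hr, abs_mul, abs_of_nonneg hθ.1]
                nlinarith [hθ.2, hθ.1, abs_nonneg (z.2 - r)]
          nlinarith [norm_nonneg y]
        linarith [norm_add_le (θ • (z.1 - x)) ((r + θ * (z.2 - r)) • y)]
      linarith [hrout k]
    have hfd := h.enorm_fderiv_convolution_le hΩ.measurableSet hδΩ huS.locallyIntegrable (φ k) hsub
    rw [hd]
    refine (ContinuousLinearMap.le_opENorm _ _).trans ?_
    refine mul_le_mul' (hfd.trans (le_of_eq ?_)) ?_
    · refine lintegral_congr fun t => ?_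
      rw [show γ θ - t = (x + θ • (z.1 - x) - t) + (r + θ * (z.2 - r)) • y by
        simp only [hγ]; module]
    · rw [← ofReal_norm]
      refine ENNReal.ofReal_le_ofReal ((norm_add_le _ _).trans ?_)
      rw [norm_smul, Real.norm_eq_abs, hρ]
      nlinarith [abs_nonneg (z.2 - r)]
  -- By Tonelli the average in y can be taken first, with θ and t fixed. It is then an average of
  -- |g| over a slightly moved ball, hence at most c, and the mollifier has mass one.
  have hk : ∀ k, ∫⁻ y, ‖w k (z.1 + z.2 • y) - w k (x + r • y)‖ₑ ∂ν ≤ c * ENNReal.ofReal ρ := by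
    intro k
    have hfm : Measurable fun t => ENNReal.ofReal ((φ k).normed volume t) :=
      ((φ k).continuous_normed).measurable.ennreal_ofReal
    calc ∫⁻ y, ‖w k (z.1 + z.2 • y) - w k (x + r • y)‖ₑ ∂ν
        ≤ ∫⁻ y, (∫⁻ θ in Icc (0 : ℝ) 1, (∫⁻ t, ENNReal.ofReal ((φ k).normed volume t) *
            ‖g ((x + θ • (z.1 - x) - t) + (r + θ * (z.2 - r)) • y)‖ₑ) * ENNReal.ofReal ρ) ∂ν :=
          lintegral_mono_ae (hνb.mono fun y hy => hline k y hy)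
      _ = ∫⁻ θ in Icc (0 : ℝ) 1, ∫⁻ y, (∫⁻ t, ENNReal.ofReal ((φ k).normed volume t) *
            ‖g ((x + θ • (z.1 - x) - t) + (r + θ * (z.2 - r)) • y)‖ₑ) * ENNReal.ofReal ρ ∂ν := by
          rw [lintegral_lintegral_swap]
          refine Measurable.aemeasurable (Measurable.mul_const ?_ _)
          apply Measurable.lintegral_prod_right'
            (f := fun q : (EuclideanSpace ℝ (Fin n) × ℝ) × EuclideanSpace ℝ (Fin n) =>
              ENNReal.ofReal ((φ k).normed volume q.2) *
              ‖g ((x + q.1.2 • (z.1 - x) - q.2) + (r + q.1.2 * (z.2 - r)) • q.1.1)‖ₑ)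
          exact (hfm.comp measurable_snd).mul (by fun_prop)
      _ = ∫⁻ θ in Icc (0 : ℝ) 1, (∫⁻ t, ENNReal.ofReal ((φ k).normed volume t) *
            ∫⁻ y, ‖g ((x + θ • (z.1 - x) - t) + (r + θ * (z.2 - r)) • y)‖ₑ ∂ν) *
              ENNReal.ofReal ρ := by
          refine lintegral_congr fun θ => ?_
          rw [lintegral_mul_const' _ _ ENNReal.ofReal_ne_top, lintegral_lintegral_swap]
          · congr 1
            refine lintegral_congr fun t => ?_
            rw [lintegral_const_mul' _ _ ENNReal.ofReal_ne_top]
          · exact ((hfm.comp measurable_snd).mul (by fun_prop)).aemeasurable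
      _ ≤ ∫⁻ θ in Icc (0 : ℝ) 1, (∫⁻ t, ENNReal.ofReal ((φ k).normed volume t) * c) *
              ENNReal.ofReal ρ := by
          refine setLIntegral_mono' measurableSet_Icc fun θ hθ => ?_
          gcongr ?_ * _
          refine lintegral_mono fun t => ?_
          by_cases ht : t ∈ ball (0 : EuclideanSpace ℝ (Fin n)) (φ k).rOut
          · gcongr
            refine havg _ _ ?_ ?_
            · rw [mem_ball_zero_iff] at ht
              rw [dist_eq_norm, show x + θ • (z.1 - x) - t - x = θ • (z.1 - x) - t by module]
              have ha : ‖θ • (z.1 - x)‖ ≤ ‖z.1 - x‖ := by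
                rw [norm_smul, Real.norm_of_nonneg hθ.1]
                nlinarith [hθ.2, norm_nonneg (z.1 - x)]
              rw [dist_eq_norm] at hz1
              linarith [norm_sub_le (θ • (z.1 - x)) t, hrout k]
            · rw [add_sub_cancel_left, abs_mul, abs_of_nonneg hθ.1]
              nlinarith [hθ.2, hθ.1, abs_nonneg (z.2 - r)]
          · have : (φ k).normed volume t = 0 := by
              rw [← (φ k).support_normed_eq (μ := volume)] at ht
              exact Function.notMem_support.1 ht
            rw [this]
            simp
      _ = c * ENNReal.ofReal ρ := by
          have h1 : ∫⁻ t, ENNReal.ofReal ((φ k).normed volume t) = 1 := by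
            rw [← ofReal_integral_eq_lintegral_ofReal (φ k).integrable_normed
              (ae_of_all _ (φ k).nonneg_normed), (φ k).integral_normed, ENNReal.ofReal_one]
          rw [lintegral_mul_const _ hfm, h1, one_mul, setLIntegral_const]
          simp
  change ∫⁻ y, ‖u (z.1 + z.2 • y) - u (x + r • y)‖ₑ ∂ν ≤ _
  have hrr : |r - r| < η := by simpa using hη
  -- Fatou's lemma removes the mollification.
  calc ∫⁻ y, ‖u (z.1 + z.2 • y) - u (x + r • y)‖ₑ ∂ν
      ≤ ∫⁻ y, liminf (fun k => ‖w k (z.1 + z.2 • y) - w k (x + r • y)‖ₑ) atTop ∂ν := by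
        refine lintegral_mono_ae ?_
        filter_upwards [hwlim z.1 z.2 hz1 hz2, hwlim x r (by simpa using hη) hrr] with y hy1 hy2
        exact (hy1.sub hy2).enorm.liminf_eq.ge
    _ ≤ liminf (fun k => ∫⁻ y, ‖w k (z.1 + z.2 • y) - w k (x + r • y)‖ₑ ∂ν) atTop := by
        refine lintegral_liminf_le fun k => ?_
        have := (hwsmooth k).continuous.measurable
        fun_prop
    _ ≤ c * ENNReal.ofReal ρ := by
        refine liminf_le_of_le (by isBoundedDefault) fun b hb => ?_
        obtain ⟨k, hk'⟩ := hb.exists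
        exact hk'.trans (hk k)

/-! ### The segment inequality for the maximal function -/

theorem setLAverage_enorm_le_add {n : ℕ} {u : EuclideanSpace ℝ (Fin n) → ℝ} (hu : Measurable u)
    {x x' : EuclideanSpace ℝ (Fin n)} {r r' : ℝ} (hr : 0 < r) (hr' : 0 < r') :
    ⨍⁻ y in ball x' r', ‖u y‖ₑ ∂volume ≤ ⨍⁻ y in ball x r, ‖u y‖ₑ ∂volume +
      ⨍⁻ y in ball (0 : EuclideanSpace ℝ (Fin n)) 1, ‖u (x' + r' • y) - u (x + r • y)‖ₑ ∂volume := by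
  rw [setLAverage_ball_eq _ x hr, setLAverage_ball_eq _ x' hr', laverage_eq', laverage_eq',
    laverage_eq', ← lintegral_add_left (by fun_prop)]
  refine lintegral_mono fun y => ?_
  calc ‖u (x' + r' • y)‖ₑ = ‖u (x + r • y) + (u (x' + r' • y) - u (x + r • y))‖ₑ := by
        rw [add_sub_cancel]
    _ ≤ _ := enorm_add_le _ _

/-- Product rule for the upper right Dini derivative of S^α b, where b is controlled only from
above. The factor 2 appears because L|z-τ| and |S z - R| are both at most L|z-τ|. The constant c
precedes `S` and `b` because the mean Lipschitz estimate is available for every c > A, though not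
for A itself. -/
theorem slope_rpow_mul_lt {R a A L α ρ : ℝ} (hR : 0 < R) (ha : 0 ≤ a)
    (hα : 0 ≤ α) (hρ : L * (α * R ^ (α - 1) * a + 2 * (R ^ α * A)) < ρ) :
    ∃ c > A, ∀ (S b : ℝ → ℝ) (τ : ℝ), S τ = R → b τ = a → (∀ z, |S z - R| ≤ L * |z - τ|) →
      (∀ᶠ z in 𝓝 τ, b z ≤ a + c * (L * |z - τ| + |S z - R|)) → 0 ≤ c →
      ∀ᶠ z in 𝓝[>] τ, slope (fun z => S z ^ α * b z) τ z < ρ := by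
  have hcont1 : ContinuousAt (fun ε : ℝ =>
      L * ((α * R ^ (α - 1) + ε) * a + 2 * (R ^ α * (A + ε)))) 0 := by fun_prop
  have h1 := hcont1.eventually (gt_mem_nhds (show _ < ρ by simpa using hρ))
  obtain ⟨ε, hερ, hε⟩ : ∃ ε : ℝ, L * ((α * R ^ (α - 1) + ε) * a + 2 * (R ^ α * (A + ε))) < ρ ∧ 0 < ε :=
    ((h1.filter_mono nhdsWithin_le_nhds).and (self_mem_nhdsWithin (s := Ioi (0 : ℝ)))).exists
  refine ⟨A + ε, by linarith, fun S b τ hSτ hbτ hS hb hc => ?_⟩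
  have hSc : Tendsto S (𝓝 τ) (𝓝 R) := by
    rw [tendsto_iff_dist_tendsto_zero]
    refine squeeze_zero (fun _ => dist_nonneg) hS ?_
    have : Continuous fun z : ℝ => L * |z - τ| := by fun_prop
    simpa using this.tendsto τ
  have hpow : ContinuousAt (fun s : ℝ => s ^ α) R := Real.continuousAt_rpow_const _ _ (Or.inl hR.ne')
  have h2 : ∀ᶠ s in 𝓝 R, L * ((α * R ^ (α - 1) + ε) * a + 2 * (s ^ α * (A + ε))) < ρ := by
    have : ContinuousAt (fun s : ℝ => L * ((α * R ^ (α - 1) + ε) * a + 2 * (s ^ α * (A + ε)))) R := by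
      fun_prop
    exact this.eventually (gt_mem_nhds hερ)
  have h3 : ∀ᶠ s in 𝓝 R, ‖s ^ α - R ^ α - (s - R) • (α * R ^ (α - 1))‖ ≤ ε * ‖s - R‖ :=
    (hasDerivAt_iff_isLittleO.1 (Real.hasDerivAt_rpow_const (p := α) (Or.inl hR.ne'))).def hε
  have h4 : ∀ᶠ s in 𝓝 R, 0 < s := lt_mem_nhds hR
  have h5 := (hSc.eventually (h2.and (h3.and h4))).and hb
  filter_upwards [h5.filter_mono nhdsWithin_le_nhds, self_mem_nhdsWithin] with z ⟨⟨hz2, hz3, hz4⟩, hzb⟩ hz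
  have hz0 : 0 < z - τ := sub_pos.2 hz
  rw [slope_def_field, div_lt_iff₀ hz0]
  refine lt_of_le_of_lt ?_ (mul_lt_mul_of_pos_right hz2 hz0)
  have hSz := hS z
  rw [abs_of_pos hz0] at hSz hzb
  have hαR : 0 ≤ α * R ^ (α - 1) := mul_nonneg hα (Real.rpow_nonneg hR.le _)
  have e1 : S z ^ α - R ^ α ≤ (α * R ^ (α - 1) + ε) * (L * (z - τ)) := by
    rw [Real.norm_eq_abs, Real.norm_eq_abs, smul_eq_mul] at hz3
    have := (abs_le.1 hz3).2
    have h' : (S z - R) * (α * R ^ (α - 1)) ≤ |S z - R| * (α * R ^ (α - 1)) :=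
      mul_le_mul_of_nonneg_right (le_abs_self _) hαR
    calc S z ^ α - R ^ α ≤ (α * R ^ (α - 1) + ε) * |S z - R| := by linarith
      _ ≤ _ := mul_le_mul_of_nonneg_left hSz (by positivity)
  have e2 : b z - a ≤ (A + ε) * (2 * L * (z - τ)) := by
    have : (A + ε) * (L * (z - τ) + |S z - R|) ≤ (A + ε) * (2 * L * (z - τ)) :=
      mul_le_mul_of_nonneg_left (by linarith) hc
    linarith
  have hzp : 0 ≤ S z ^ α := Real.rpow_nonneg hz4.le _
  rw [hSτ, hbτ]
  calc S z ^ α * b z - R ^ α * a = (S z ^ α - R ^ α) * a + S z ^ α * (b z - a) := by ring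
    _ ≤ (α * R ^ (α - 1) + ε) * (L * (z - τ)) * a + S z ^ α * ((A + ε) * (2 * L * (z - τ))) :=
      add_le_add (mul_le_mul_of_nonneg_right e1 ha) (mul_le_mul_of_nonneg_left e2 hzp)
    _ = _ := by ring

/-- The function `2 M_α|g| + α M_{α-1} u` is an upper gradient of `M_α u` along segments. -/
theorem HasWeakGradient.localFracMax_le_add {n : ℕ} {Ω : Set (EuclideanSpace ℝ (Fin n))}
    (hΩ : IsOpen Ω) (hΩc : Ωᶜ.Nonempty) {u : EuclideanSpace ℝ (Fin n) → ℝ}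
    {g : EuclideanSpace ℝ (Fin n) → EuclideanSpace ℝ (Fin n)}
    (h : HasWeakGradient Ω u g) (hum : Measurable u) (hgm : Measurable g) {α : ℝ} (hα : 0 ≤ α)
    {x v : EuclideanSpace ℝ (Fin n)} (hxv : ∀ θ ∈ Icc (0 : ℝ) 1, x + θ • v ∈ Ω) :
    localFracMax α Ω u (x + v) ≤ localFracMax α Ω u x +
      ‖v‖ₑ * ∫⁻ θ in Icc (0 : ℝ) 1, (2 * localFracMax α Ω (fun y => ‖g y‖) (x + θ • v) +
        ENNReal.ofReal α * localFracMax (α - 1) Ω u (x + θ • v)) := by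
  refine iSup_le fun r => iSup_le fun hr => iSup_le fun hrx => ?_
  have hdpos : ∀ y ∈ Ω, 0 < infDist y Ωᶜ := fun y hy =>
    (hΩ.isClosed_compl.notMem_iff_infDist_pos hΩc).1 (by simpa using hy)
  have hed : ∀ y, infEDist y Ωᶜ = ENNReal.ofReal (infDist y Ωᶜ) := fun y =>
    (ENNReal.ofReal_toReal (infEDist_ne_top hΩc)).symm
  set d := infDist (x + v) Ωᶜ with hd
  have hd0 : 0 < d := hdpos _ (by simpa using hxv 1 (by simp))
  have hrd : r < d := by
    rw [hed] at hrx
    exact (ENNReal.ofReal_lt_ofReal_iff hd0).1 hrx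
  -- A fixed fraction r/d < 1 of the distance to the complement is admissible at every point of the
  -- segment, equals r at θ = 1, and inherits the Lipschitz bound of the distance. A constant radius
  -- could fail to be admissible.
  set R : ℝ → ℝ := fun θ => r / d * infDist (x + θ • v) Ωᶜ with hR
  have ht1 : r / d < 1 := (div_lt_one hd0).2 hrd
  have ht0 : 0 < r / d := by positivity
  set U : Set ℝ := {θ | x + θ • v ∈ Ω} with hU
  have hUo : IsOpen U := hΩ.preimage (by fun_prop)
  have hIU : Icc (0 : ℝ) 1 ⊆ U := hxv
  have hRpos : ∀ θ ∈ U, 0 < R θ := fun θ hθ => mul_pos ht0 (hdpos _ hθ)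
  have hRadm : ∀ θ ∈ U, ENNReal.ofReal (R θ) < infEDist (x + θ • v) Ωᶜ := by
    intro θ hθ
    rw [hed]
    refine (ENNReal.ofReal_lt_ofReal_iff (hdpos _ hθ)).2 ?_
    exact mul_lt_of_lt_one_left (hdpos _ hθ) ht1
  have hRlip : ∀ τ z, |R z - R τ| ≤ ‖v‖ * |z - τ| := by
    intro τ z
    have h1 : |infDist (x + z • v) Ωᶜ - infDist (x + τ • v) Ωᶜ| ≤ ‖v‖ * |z - τ| := by
      have := (lipschitz_infDist_pt Ωᶜ).dist_le_mul (x + z • v) (x + τ • v)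
      rw [Real.dist_eq, NNReal.coe_one, one_mul, dist_add_left, dist_eq_norm, ← sub_smul,
        norm_smul, Real.norm_eq_abs, mul_comm] at this
      exact this
    calc |R z - R τ| = r / d * |infDist (x + z • v) Ωᶜ - infDist (x + τ • v) Ωᶜ| := by
          rw [hR, ← mul_sub, abs_mul, abs_of_pos ht0]
      _ ≤ 1 * |infDist (x + z • v) Ωᶜ - infDist (x + τ • v) Ωᶜ| := by gcongr
      _ ≤ _ := by rwa [one_mul]
  have hRc : Continuous R := by
    refine continuous_const.mul ((continuous_infDist_pt _).comp ?_)
    fun_prop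
  have hball : ∀ θ ∈ U, closedBall (x + θ • v) (R θ) ⊆ Ω := fun θ hθ =>
    closedBall_subset_of_ofReal_lt_infEDist (hRadm θ hθ)
  have hfinite : ∀ {F : Type} [NormedAddCommGroup F] {w : EuclideanSpace ℝ (Fin n) → F},
      LocallyIntegrableOn w Ω → ∀ θ ∈ U, ∃ R' > R θ, ∫⁻ y in ball (x + θ • v) R', ‖w y‖ₑ < ∞ := by
    intro F _ w hw θ hθ
    obtain ⟨δ, hδ, hδΩ⟩ :=
      (isCompact_closedBall (x + θ • v) (R θ)).exists_cthickening_subset_open hΩ (hball θ hθ)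
    rw [cthickening_closedBall hδ.le (hRpos θ hθ).le] at hδΩ
    refine ⟨δ + R θ, by linarith, (lintegral_mono_set ball_subset_closedBall).trans_lt ?_⟩
    exact (hw.integrableOn_compact_subset hδΩ (isCompact_closedBall _ _)).2
  set a : ℝ → ℝ≥0∞ := fun θ => ⨍⁻ y in ball (x + θ • v) (R θ), ‖u y‖ₑ ∂volume with ha
  set A : ℝ → ℝ≥0∞ := fun θ => ⨍⁻ y in ball (x + θ • v) (R θ), ‖g y‖ₑ ∂volume with hA
  have hafin : ∀ θ ∈ U, a θ ≠ ∞ := by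
    intro θ hθ
    obtain ⟨R', hR', hf⟩ := hfinite h.1 θ hθ
    exact (laverage_lt_top ((lintegral_mono_set (ball_subset_ball hR'.le)).trans_lt hf).ne).ne
  have hAfin : ∀ θ ∈ U, A θ ≠ ∞ := by
    intro θ hθ
    obtain ⟨R', hR', hf⟩ := hfinite h.2.1 θ hθ
    exact (laverage_lt_top ((lintegral_mono_set (ball_subset_ball hR'.le)).trans_lt hf).ne).ne
  have hpair : Continuous fun θ : ℝ => (x + θ • v, R θ) := by fun_prop
  have hac : ∀ θ ∈ U, ContinuousAt (fun θ => (a θ).toReal) θ := by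
    intro θ hθ
    obtain ⟨R', hR', hf⟩ := hfinite h.1 θ hθ
    exact (ENNReal.tendsto_toReal (hafin θ hθ)).comp
      ((continuousAt_setLAverage_ball hum.enorm (hRpos θ hθ) hR' hf).comp
        (f := fun θ : ℝ => (x + θ • v, R θ)) hpair.continuousAt)
  have hAc : ∀ θ ∈ U, ContinuousAt (fun θ => (A θ).toReal) θ := by
    intro θ hθ
    obtain ⟨R', hR', hf⟩ := hfinite h.2.1 θ hθ
    exact (ENNReal.tendsto_toReal (hAfin θ hθ)).comp
      ((continuousAt_setLAverage_ball hgm.enorm (hRpos θ hθ) hR' hf).comp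
        (f := fun θ : ℝ => (x + θ • v, R θ)) hpair.continuousAt)
  have hpowc : ∀ β : ℝ, ∀ θ ∈ U, ContinuousAt (fun θ => R θ ^ β) θ := fun β θ hθ =>
    hRc.continuousAt.rpow_const (Or.inl (hRpos θ hθ).ne')
  set f : ℝ → ℝ := fun θ => R θ ^ α * (a θ).toReal with hf
  set G : ℝ → ℝ := fun θ =>
    ‖v‖ * (α * R θ ^ (α - 1) * (a θ).toReal + 2 * (R θ ^ α * (A θ).toReal)) with hG
  have hfc : ContinuousOn f U := fun θ hθ =>
    ((hpowc α θ hθ).mul (hac θ hθ)).continuousWithinAt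
  have hGc : ∀ θ ∈ U, ContinuousAt G θ := fun θ hθ =>
    (((continuousAt_const.mul (hpowc (α - 1) θ hθ)).mul (hac θ hθ)).add
      (continuousAt_const.mul ((hpowc α θ hθ).mul (hAc θ hθ)))).const_mul ‖v‖
  have hGcon : ContinuousOn G U := fun θ hθ => (hGc θ hθ).continuousWithinAt
  have hGint : ∀ θ ∈ Icc (0 : ℝ) 1, IntervalIntegrable G volume 0 θ := by
    intro θ hθ
    refine ContinuousOn.intervalIntegrable (hGcon.mono ?_)
    rw [uIcc_of_le hθ.1]
    exact (Icc_subset_Icc_right hθ.2).trans hIU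
  have hBd : ∀ θ ∈ Icc (0 : ℝ) 1, HasDerivAt (fun θ => f 0 + ∫ s in (0 : ℝ)..θ, G s) (G θ) θ :=
    fun θ hθ => (intervalIntegral.integral_hasDerivAt_right (hGint θ hθ)
      (hGcon.stronglyMeasurableAtFilter hUo θ (hIU hθ)) (hGc θ (hIU hθ))).const_add _
  -- Differentiability of `f` is not available, so the comparison theorem for continuous functions
  -- with bounded right slopes replaces the fundamental theorem of calculus.
  have hmain : f 1 ≤ f 0 + ∫ s in (0 : ℝ)..1, G s := by
    refine image_le_of_liminf_slope_right_le_deriv_boundary (f := f) (a := 0) (b := 1) (hfc.mono hIU)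
      (B := fun θ => f 0 + ∫ s in (0 : ℝ)..θ, G s) (B' := G) (by simp)
      (fun θ hθ => (hBd θ hθ).continuousAt.continuousWithinAt)
      (fun θ hθ => (hBd θ (Ico_subset_Icc_self hθ)).hasDerivWithinAt) ?_ (right_mem_Icc.2 zero_le_one)
    intro τ hτ ρ hρ
    have hτU := hIU (Ico_subset_Icc_self hτ)
    obtain ⟨c, hcA, hc⟩ := slope_rpow_mul_lt (hRpos τ hτU) ENNReal.toReal_nonneg hα hρ
    have hc0 : 0 ≤ c := ENNReal.toReal_nonneg.trans hcA.le
    refine (hc R (fun θ => (a θ).toReal) τ rfl rfl (hRlip τ) ?_ hc0).frequently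
    have hA' : A τ < ENNReal.ofReal c := (ENNReal.lt_ofReal_iff_toReal_lt (hAfin τ hτU)).2 hcA
    have hev := hpair.continuousAt.eventually
      (h.eventually_setLAverage_enorm_sub_le hΩ hgm (hRpos τ hτU) (hball τ hτU) hA')
    filter_upwards [hev, hUo.mem_nhds hτU] with z hz hzU
    have h1 := (setLAverage_enorm_le_add hum (x := x + τ • v) (x' := x + z • v) (hRpos τ hτU)
      (hRpos z hzU)).trans (add_le_add_right hz _)
    have e : ‖x + z • v - (x + τ • v)‖ = ‖v‖ * |z - τ| := by
      rw [add_sub_add_left_eq_sub, ← sub_smul, norm_smul, Real.norm_eq_abs, mul_comm]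
    simp only [e] at h1
    refine ENNReal.toReal_le_of_le_ofReal (by positivity) (h1.trans (le_of_eq ?_))
    rw [ENNReal.ofReal_add ENNReal.toReal_nonneg (by positivity),
      ENNReal.ofReal_toReal (hafin τ hτU), ENNReal.ofReal_mul hc0]
  have hR1 : R 1 = r := by
    simp only [hR, one_smul]
    exact div_mul_cancel₀ _ hd0.ne'
  have hofReal : ∀ β : ℝ, ∀ θ ∈ U, ∀ b : ℝ≥0∞, b ≠ ∞ → ENNReal.ofReal (R θ ^ β * b.toReal) =
      ENNReal.ofReal (R θ) ^ β * b := by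
    intro β θ hθ b hb
    rw [ENNReal.ofReal_mul (Real.rpow_nonneg (hRpos θ hθ).le _), ENNReal.ofReal_toReal hb,
      ENNReal.ofReal_rpow_of_pos (hRpos θ hθ)]
  have h0U : (0 : ℝ) ∈ U := hIU (by simp)
  have h1U : (1 : ℝ) ∈ U := hIU (by simp)
  have hGnn : ∀ θ ∈ U, 0 ≤ G θ := by
    intro θ hθ
    have := hRpos θ hθ
    positivity
  have hGle : ∀ θ ∈ U, ENNReal.ofReal (G θ) ≤ ‖v‖ₑ * (2 * localFracMax α Ω (fun y => ‖g y‖)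
      (x + θ • v) + ENNReal.ofReal α * localFracMax (α - 1) Ω u (x + θ • v)) := by
    intro θ hθ
    have hRθ := hRpos θ hθ
    rw [hG, ENNReal.ofReal_mul (norm_nonneg _), ofReal_norm, ENNReal.ofReal_add (by positivity)
      (by positivity), mul_assoc α, ENNReal.ofReal_mul hα, ENNReal.ofReal_mul (p := 2) (by norm_num),
      hofReal _ θ hθ _ (hafin θ hθ), hofReal _ θ hθ _ (hAfin θ hθ), add_comm, ENNReal.ofReal_ofNat]
    gcongr
    · have := le_localFracMax (α := α) (u := fun y => ‖g y‖) hRθ (hRadm θ hθ)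
      simpa only [enorm_norm] using this
    · exact le_localFracMax hRθ (hRadm θ hθ)
  have e1 : ENNReal.ofReal (f 1) =
      ENNReal.ofReal r ^ α * ⨍⁻ y in ball (x + v) r, ‖u y‖ₑ ∂volume := by
    rw [hf, hofReal α 1 h1U _ (hafin 1 h1U), ha]
    simp only [hR1, one_smul]
  have e0 : ENNReal.ofReal (f 0) ≤ localFracMax α Ω u x := by
    rw [hf, hofReal α 0 h0U _ (hafin 0 h0U)]
    have := le_localFracMax (α := α) (u := u) (hRpos 0 h0U) (hRadm 0 h0U)
    simpa [ha] using this
  rw [← e1]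
  calc ENNReal.ofReal (f 1) ≤ ENNReal.ofReal (f 0) + ENNReal.ofReal (∫ s in (0 : ℝ)..1, G s) :=
        (ENNReal.ofReal_le_ofReal hmain).trans ENNReal.ofReal_add_le
    _ ≤ _ := by
        refine add_le_add e0 ?_
        rw [intervalIntegral.integral_of_le zero_le_one, restrict_Ioc_eq_restrict_Icc,
          ofReal_integral_eq_lintegral_ofReal, ← lintegral_const_mul' _ _ enorm_ne_top]
        · exact setLIntegral_mono' measurableSet_Icc fun θ hθ => hGle θ (hIU hθ)
        · exact (hGcon.mono hIU).integrableOn_Icc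
        · exact (ae_restrict_iff' measurableSet_Icc).2 (ae_of_all _ fun θ hθ => hGnn θ (hIU hθ))

/-! ### From the segment inequality to distributional derivatives -/

theorem ENNReal.enorm_toReal_sub_toReal_le {a b c : ℝ≥0∞} (ha : a ≠ ∞) (hb : b ≠ ∞)
    (hab : a ≤ b + c) (hba : b ≤ a + c) : ‖a.toReal - b.toReal‖ₑ ≤ c := by
  rcases eq_or_ne c ∞ with rfl | hc
  · exact le_top
  rw [← ofReal_norm, Real.norm_eq_abs]
  refine ENNReal.ofReal_le_of_le_toReal (abs_sub_le_iff.2 ⟨?_, ?_⟩)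
  · have := ENNReal.toReal_mono (by finiteness) hab
    rw [ENNReal.toReal_add hb hc] at this
    linarith
  · have := ENNReal.toReal_mono (by finiteness) hba
    rw [ENNReal.toReal_add ha hc] at this
    linarith

theorem setLIntegral_Icc_comp_one_sub (f : ℝ → ℝ≥0∞) :
    ∫⁻ θ in Icc (0 : ℝ) 1, f (1 - θ) = ∫⁻ θ in Icc (0 : ℝ) 1, f θ := by
  rw [← lintegral_indicator measurableSet_Icc, ← lintegral_indicator measurableSet_Icc,
    ← lintegral_sub_left_eq_self _ (1 : ℝ)]
  refine lintegral_congr fun θ => ?_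
  have : (1 - θ ∈ Icc (0 : ℝ) 1) ↔ θ ∈ Icc (0 : ℝ) 1 := by
    simp only [mem_Icc]; constructor <;> rintro ⟨h1, h2⟩ <;> constructor <;> linarith
  by_cases h : θ ∈ Icc (0 : ℝ) 1
  · rw [indicator_of_mem h, indicator_of_mem (this.2 h), sub_sub_cancel]
  · rw [indicator_of_notMem h, indicator_of_notMem (fun h' => h (this.1 h'))]

/-- A function with an integrable upper gradient `H` along segments has distributional
derivatives dominated by `H`. -/
theorem enorm_integral_mul_fderiv_le_of_segment {n : ℕ} {Ω : Set (EuclideanSpace ℝ (Fin n))}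
    (hΩ : IsOpen Ω) {M H : EuclideanSpace ℝ (Fin n) → ℝ≥0∞} (hM : Measurable M)
    (hH : Measurable H) (hMfin : ∫⁻ x in Ω, M x < ∞) (hHfin : ∫⁻ x in Ω, H x < ∞)
    (hMH : ∀ x v : EuclideanSpace ℝ (Fin n), (∀ θ ∈ Icc (0 : ℝ) 1, x + θ • v ∈ Ω) →
      M (x + v) ≤ M x + ‖v‖ₑ * ∫⁻ θ in Icc (0 : ℝ) 1, H (x + θ • v))
    {φ : EuclideanSpace ℝ (Fin n) → ℝ} (hφ : ContDiff ℝ ((⊤ : ℕ∞) : WithTop ℕ∞) φ)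
    (hφc : HasCompactSupport φ) (hφΩ : tsupport φ ⊆ Ω) (e : EuclideanSpace ℝ (Fin n)) :
    ‖∫ x in Ω, (M x).toReal * fderiv ℝ φ x e‖ₑ ≤ ‖e‖ₑ * ∫⁻ x in Ω, H x * ‖φ x‖ₑ := by
  have hφ1 : ContDiff ℝ 1 φ := hφ.of_le (by exact_mod_cast le_top)
  set V := Ω.indicator fun x => (M x).toReal with hV
  have hVint : Integrable V := by
    refine (integrable_indicator_iff hΩ.measurableSet).2 ?_
    exact integrable_toReal_of_lintegral_ne_top hM.aemeasurable hMfin.ne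
  have hMae : ∀ᵐ x : EuclideanSpace ℝ (Fin n), x ∈ Ω → M x < ∞ :=
    (ae_restrict_iff' hΩ.measurableSet).1 (ae_lt_top hM hMfin.ne)
  set H' := Ω.indicator H with hH'
  have hH'm : Measurable H' := hH.indicator hΩ.measurableSet
  have hH'fin : ∫⁻ x, H' x = ∫⁻ x in Ω, H x := lintegral_indicator hΩ.measurableSet _
  obtain ⟨C, hC⟩ := hφ1.lipschitzWith_of_hasCompactSupport hφc one_ne_zero
  obtain ⟨δ, hδ, hδΩ⟩ := hφc.isCompact.exists_cthickening_subset_open hΩ hφΩ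
  -- The difference quotient is placed on `φ`, where the limit s → 0 is dominated convergence;
  -- translation invariance then moves it to `V`, where the segment inequality applies.
  let D : ℝ → ℝ := fun s => ∫ x, V x * (s⁻¹ * (φ (x + s • e) - φ x))
  have hlim : Tendsto D (𝓝[>] 0) (𝓝 (∫ x, V x * fderiv ℝ φ x e)) := by
    refine tendsto_integral_filter_of_dominated_convergence (fun x => ‖V x‖ * (C * ‖e‖)) ?_ ?_
      (hVint.norm.mul_const _) ?_
    · refine Eventually.of_forall fun s => hVint.aestronglyMeasurable.mul ?_
      exact Continuous.aestronglyMeasurable (by have := hφ.continuous; fun_prop)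
    · filter_upwards [self_mem_nhdsWithin] with s hs
      refine ae_of_all _ fun x => ?_
      have hs0 : 0 < s := hs
      rw [norm_mul, norm_mul, norm_inv, Real.norm_of_nonneg hs0.le]
      refine mul_le_mul_of_nonneg_left ?_ (norm_nonneg _)
      have := hC.dist_le_mul (x + s • e) x
      rw [dist_self_add_left, norm_smul, Real.norm_of_nonneg hs0.le, dist_eq_norm] at this
      rw [inv_mul_le_iff₀ hs0]
      linarith
    · refine ae_of_all _ fun x => Tendsto.const_mul _ ?_
      exact ((hφ1.differentiable one_ne_zero x).hasFDerivAt.hasLineDerivAt e).tendsto_slope_zero_right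
  have hbd : ∃ B, ∀ x, ‖φ x‖ ≤ B := hφc.exists_bound_of_continuous hφ.continuous
  obtain ⟨B, hB⟩ := hbd
  have hD : ∀ s > 0, D s = ∫ x, s⁻¹ * ((V (x - s • e) - V x) * φ x) := by
    intro s hs
    have i1 : Integrable fun x => V x * φ (x + s • e) :=
      hVint.mul_bdd (Continuous.aestronglyMeasurable (by have := hφ.continuous; fun_prop))
        (ae_of_all _ fun x => hB _)
    have i2 : Integrable fun x => V x * φ x :=
      hVint.mul_bdd hφ.continuous.aestronglyMeasurable (ae_of_all _ fun x => hB _)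
    have i3 : Integrable fun x => V (x - s • e) * φ x := by
      have := i1.comp_sub_right (s • e)
      simpa using this
    have e1 : ∫ x, V x * φ (x + s • e) = ∫ x, V (x - s • e) * φ x := by
      rw [← integral_sub_right_eq_self _ (s • e)]
      simp
    calc D s = s⁻¹ * (∫ x, V x * φ (x + s • e) - V x * φ x) := by
          rw [← integral_const_mul]
          refine integral_congr_ae (ae_of_all _ fun x => ?_)
          change V x * (s⁻¹ * (φ (x + s • e) - φ x)) = s⁻¹ * (V x * φ (x + s • e) - V x * φ x)
          ring
      _ = s⁻¹ * (∫ x, V (x - s • e) * φ x - V x * φ x) := by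
          rw [integral_sub i1 i2, e1, integral_sub i3 i2]
      _ = _ := by
          rw [← integral_const_mul]
          simp_rw [sub_mul]
  have hbound : ∀ s : ℝ, 0 < s → s * ‖e‖ ≤ δ → ‖D s‖ₑ ≤
      ‖e‖ₑ * ((∫⁻ x, H' x * ‖φ x‖ₑ) + (∫⁻ x, H' x) * ENNReal.ofReal (C * (s * ‖e‖))) := by
    intro s hs hsδ
    have hseg : ∀ x ∈ tsupport φ, ∀ θ ∈ Icc (0 : ℝ) 1, x - (θ * s) • e ∈ Ω := by
      intro x hx θ hθ
      refine hδΩ (mem_cthickening_of_dist_le _ x δ _ hx ?_)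
      rw [dist_eq_norm, sub_sub_cancel_left, norm_neg, norm_smul, Real.norm_of_nonneg (mul_nonneg hθ.1 hs.le)]
      have : θ * (s * ‖e‖) ≤ 1 * (s * ‖e‖) := by gcongr; exact hθ.2
      linarith
    have hMae' : ∀ᵐ x : EuclideanSpace ℝ (Fin n), x - s • e ∈ Ω → M (x - s • e) < ∞ :=
      (measurePreserving_sub_right volume (s • e)).quasiMeasurePreserving.ae hMae
    have hpt : ∀ᵐ x, ‖s⁻¹ * ((V (x - s • e) - V x) * φ x)‖ₑ ≤
        ‖e‖ₑ * ∫⁻ θ in Icc (0 : ℝ) 1, H' (x - (θ * s) • e) * ‖φ x‖ₑ := by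
      filter_upwards [hMae, hMae'] with x hx1 hx2
      by_cases hx : x ∈ tsupport φ
      swap
      · rw [image_eq_zero_of_notMem_tsupport hx]; simp
      have hxΩ : x ∈ Ω := hφΩ hx
      have hxsΩ : x - s • e ∈ Ω := by simpa using hseg x hx 1 (by simp)
      set J := ∫⁻ θ in Icc (0 : ℝ) 1, H' (x - (θ * s) • e) with hJ
      have hVV : ‖V (x - s • e) - V x‖ₑ ≤ ‖s • e‖ₑ * J := by
        rw [hV, indicator_of_mem hxΩ, indicator_of_mem hxsΩ]
        refine ENNReal.enorm_toReal_sub_toReal_le (hx2 hxsΩ).ne (hx1 hxΩ).ne ?_ ?_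
        · have h1 : ∀ θ : ℝ, x + θ • -(s • e) = x - (θ * s) • e := fun θ => by module
          have := hMH x (-(s • e)) fun θ hθ => by rw [h1]; exact hseg x hx θ hθ
          rw [enorm_neg, ← sub_eq_add_neg] at this
          refine this.trans (le_of_eq ?_)
          congr 2
          refine setLIntegral_congr_fun measurableSet_Icc fun θ hθ => ?_
          rw [h1, hH', indicator_of_mem (hseg x hx θ hθ)]
        -- The same segment is traversed backwards, hence the reflection θ ↦ 1-θ.
        · have h1 : ∀ θ : ℝ, x - s • e + θ • (s • e) = x - ((1 - θ) * s) • e := fun θ => by module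
          have hθ' : ∀ θ ∈ Icc (0 : ℝ) 1, 1 - θ ∈ Icc (0 : ℝ) 1 := fun θ hθ =>
            ⟨by linarith [hθ.2], by linarith [hθ.1]⟩
          have := hMH (x - s • e) (s • e) fun θ hθ => by rw [h1]; exact hseg x hx _ (hθ' θ hθ)
          rw [sub_add_cancel] at this
          refine this.trans (le_of_eq ?_)
          congr 2
          rw [hJ, ← setLIntegral_Icc_comp_one_sub fun θ => H' (x - (θ * s) • e)]
          refine setLIntegral_congr_fun measurableSet_Icc fun θ hθ => ?_
          rw [h1, hH', indicator_of_mem (hseg x hx _ (hθ' θ hθ))]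
      rw [lintegral_mul_const' _ _ enorm_ne_top, enorm_mul, enorm_mul]
      calc ‖s⁻¹‖ₑ * (‖V (x - s • e) - V x‖ₑ * ‖φ x‖ₑ)
          ≤ ‖s⁻¹‖ₑ * (‖s • e‖ₑ * J * ‖φ x‖ₑ) := by gcongr
        _ = (‖s⁻¹‖ₑ * ‖s‖ₑ) * (‖e‖ₑ * (J * ‖φ x‖ₑ)) := by rw [enorm_smul]; ring
        _ = _ := by rw [← enorm_mul, inv_mul_cancel₀ hs.ne', enorm_one, one_mul]
    rw [hD s hs]
    refine (enorm_integral_le_lintegral_enorm _).trans ((lintegral_mono_ae hpt).trans ?_)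
    rw [lintegral_const_mul' _ _ enorm_ne_top]
    gcongr
    have hφm : Measurable fun x => ‖φ x‖ₑ := hφ.continuous.measurable.enorm
    rw [lintegral_lintegral_swap]
    swap
    · refine Measurable.aemeasurable ?_
      exact (hH'm.comp (by fun_prop)).mul (hφm.comp measurable_fst)
    calc ∫⁻ θ in Icc (0 : ℝ) 1, ∫⁻ x, H' (x - (θ * s) • e) * ‖φ x‖ₑ
        ≤ ∫⁻ θ in Icc (0 : ℝ) 1,
          ((∫⁻ x, H' x * ‖φ x‖ₑ) + (∫⁻ x, H' x) * ENNReal.ofReal (C * (s * ‖e‖))) := by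
          refine setLIntegral_mono' measurableSet_Icc fun θ hθ => ?_
          -- The translation is moved from `H'` to the Lipschitz `φ`. The error is at most C s |e| ∫
          -- H', so no continuity of translations in L¹ is needed.
          have e1 : ∫⁻ x, H' (x - (θ * s) • e) * ‖φ x‖ₑ = ∫⁻ x, H' x * ‖φ (x + (θ * s) • e)‖ₑ := by
            simpa using lintegral_sub_right_eq_self (μ := volume)
              (fun x => H' x * ‖φ (x + (θ * s) • e)‖ₑ) ((θ * s) • e)
          rw [e1, ← lintegral_mul_const _ hH'm, ← lintegral_add_left (f := fun x => H' x * ‖φ x‖ₑ) (hH'm.mul hφm)]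
          refine lintegral_mono fun x => ?_
          rw [← mul_add]
          gcongr
          have h1 := hC.dist_le_mul (x + (θ * s) • e) x
          rw [dist_self_add_left, norm_smul, Real.norm_of_nonneg (mul_nonneg hθ.1 hs.le),
            dist_eq_norm] at h1
          have h2 : ‖φ (x + (θ * s) • e) - φ x‖ₑ ≤ ENNReal.ofReal (C * (s * ‖e‖)) := by
            rw [← ofReal_norm]
            refine ENNReal.ofReal_le_ofReal (h1.trans ?_)
            gcongr
            exact mul_le_of_le_one_left hs.le hθ.2
          calc ‖φ (x + (θ * s) • e)‖ₑ = ‖φ x + (φ (x + (θ * s) • e) - φ x)‖ₑ := by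
                rw [add_sub_cancel]
            _ ≤ _ := (enorm_add_le _ _).trans (add_le_add_right h2 _)
      _ = _ := by rw [setLIntegral_const]; simp
  have hright : Tendsto (fun s : ℝ => ‖e‖ₑ * ((∫⁻ x, H' x * ‖φ x‖ₑ) +
      (∫⁻ x, H' x) * ENNReal.ofReal (C * (s * ‖e‖)))) (𝓝[>] 0) (𝓝 (‖e‖ₑ * ∫⁻ x, H' x * ‖φ x‖ₑ)) := by
    refine ENNReal.Tendsto.const_mul ?_ (Or.inr enorm_ne_top)
    have h1 : Tendsto (fun s : ℝ => ENNReal.ofReal (C * (s * ‖e‖))) (𝓝[>] 0) (𝓝 0) := by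
      have : Continuous fun s : ℝ => ENNReal.ofReal (C * (s * ‖e‖)) :=
        ENNReal.continuous_ofReal.comp (by fun_prop)
      have := this.tendsto 0
      simp only [zero_mul, mul_zero, ENNReal.ofReal_zero] at this
      exact this.mono_left nhdsWithin_le_nhds
    have h2 := ENNReal.Tendsto.const_mul h1 (Or.inr (hH'fin ▸ hHfin.ne : ∫⁻ x, H' x ≠ ∞))
    simpa using tendsto_const_nhds.add h2
  have hev : ∀ᶠ s : ℝ in 𝓝[>] 0, ‖D s‖ₑ ≤
      ‖e‖ₑ * ((∫⁻ x, H' x * ‖φ x‖ₑ) + (∫⁻ x, H' x) * ENNReal.ofReal (C * (s * ‖e‖))) := by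
    have h1 : ∀ᶠ s : ℝ in 𝓝 0, s * ‖e‖ < δ :=
      (show Continuous fun s : ℝ => s * ‖e‖ by fun_prop).continuousAt.eventually
        (gt_mem_nhds (by simpa using hδ))
    filter_upwards [h1.filter_mono nhdsWithin_le_nhds, self_mem_nhdsWithin] with s hs1 hs2
    exact hbound s hs2 hs1.le
  have hfinal := le_of_tendsto_of_tendsto hlim.enorm hright hev
  have e1 : ∫ x in Ω, (M x).toReal * fderiv ℝ φ x e = ∫ x, V x * fderiv ℝ φ x e := by
    rw [← integral_indicator hΩ.measurableSet]
    congr 1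
    ext x
    rw [hV, ← indicator_mul_left Ω _ (fun x => fderiv ℝ φ x e)]
  have e2 : ∫⁻ x in Ω, H x * ‖φ x‖ₑ = ∫⁻ x, H' x * ‖φ x‖ₑ := by
    rw [← lintegral_indicator hΩ.measurableSet]
    congr 1
    ext x
    rw [hH', ← indicator_mul_left Ω _ (fun x => ‖φ x‖ₑ)]
  rw [e1, e2]
  exact hfinal

/-! ### Existence and pointwise size of weak gradients -/

/-- If testing `g` against smooth functions is dominated by testing `H`, then `|g| ≤ H` a.e. -/
theorem ae_enorm_le_of_forall_contDiff {n : ℕ} {Ω : Set (EuclideanSpace ℝ (Fin n))} (hΩ : IsOpen Ω)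
    {g : EuclideanSpace ℝ (Fin n) → EuclideanSpace ℝ (Fin n)} (hg : LocallyIntegrableOn g Ω)
    {H : EuclideanSpace ℝ (Fin n) → ℝ≥0∞} (hH : Measurable H) (hHfin : ∫⁻ x in Ω, H x < ∞)
    (h : ∀ φ : EuclideanSpace ℝ (Fin n) → ℝ, ContDiff ℝ ((⊤ : ℕ∞) : WithTop ℕ∞) φ →
      HasCompactSupport φ → tsupport φ ⊆ Ω → ∀ e : EuclideanSpace ℝ (Fin n),
      ‖∫ x in Ω, φ x * inner ℝ (g x) e‖ₑ ≤ ‖e‖ₑ * ∫⁻ x in Ω, H x * ‖φ x‖ₑ) :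
    ∀ᵐ x ∂(volume.restrict Ω), ‖g x‖ₑ ≤ H x := by
  rw [ae_restrict_iff' hΩ.measurableSet, ae_iff]
  refine measure_null_of_locally_null _ fun x₀ hx₀ => ?_
  have hx₀Ω : x₀ ∈ Ω := by
    by_contra hc
    exact hx₀ fun h' => absurd h' hc
  obtain ⟨ρ, hρ, hρΩ⟩ := Metric.nhds_basis_closedBall.mem_iff.1 (hΩ.mem_nhds hx₀Ω)
  set S := closedBall x₀ ρ with hS
  set G := S.indicator g with hG
  set h' := Ω.indicator fun x => (H x).toReal with hh'
  have hGint : Integrable G := (integrable_indicator_iff measurableSet_closedBall).2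
    (hg.integrableOn_compact_subset hρΩ (isCompact_closedBall _ _))
  have hh'int : Integrable h' := (integrable_indicator_iff hΩ.measurableSet).2
    (integrable_toReal_of_lintegral_ne_top hH.aemeasurable hHfin.ne)
  have hHae : ∀ᵐ x ∂(volume.restrict Ω), H x < ∞ := ae_lt_top hH hHfin.ne
  obtain ⟨φ, hφ1, hφ2, hφ3⟩ := exists_seq_contDiffBump n (show 0 < ρ / 2 by positivity)
  have c1 := ContDiffBump.ae_convolution_tendsto_right_of_locallyIntegrable (K := 2) (μ := volume)
    hφ2 (Eventually.of_forall hφ3) hGint.locallyIntegrable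
  have c2 := ContDiffBump.ae_convolution_tendsto_right_of_locallyIntegrable (K := 2) (μ := volume)
    hφ2 (Eventually.of_forall hφ3) hh'int.locallyIntegrable
  have hfin : ∀ᵐ x, x ∈ ball x₀ (ρ / 2) → ‖g x‖ₑ ≤ H x := by
    filter_upwards [c1, c2] with x hx1 hx2 hx
    have hxS : x ∈ S := ball_subset_closedBall (ball_subset_ball (by linarith) hx)
    rw [hG, indicator_of_mem hxS] at hx1
    rw [hh', indicator_of_mem (hρΩ hxS)] at hx2
    have hle : ‖g x‖ ≤ (H x).toReal := by
      refine le_of_tendsto_of_tendsto' hx1.norm hx2 fun k => ?_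
      rw [convolution_lsmul_swap, convolution_lsmul_swap]
      set ψ : EuclideanSpace ℝ (Fin n) → ℝ := fun t => (φ k).normed volume (x - t) with hψ
      have hψnn : ∀ t, 0 ≤ ψ t := fun t => (φ k).nonneg_normed _
      have hψsub : closedBall x (φ k).rOut ⊆ S := by
        refine closedBall_subset_closedBall' ?_
        have := mem_ball.1 hx
        linarith [hφ1 k]
      have hψS : tsupport ψ ⊆ S := ((φ k).tsupport_normed_sub_subset x).trans hψsub
      have hψc : Continuous ψ := ((φ k).contDiff_normed_sub x).continuous
      obtain ⟨B, hB⟩ := ((φ k).hasCompactSupport_normed_sub x).exists_bound_of_continuous hψc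
      set w := ∫ t, ψ t • G t with hw
      have hGi : Integrable fun t => ψ t • G t :=
        hGint.bdd_smul B hψc.aestronglyMeasurable (ae_of_all _ hB)
      have hJi : Integrable fun t => ψ t • h' t :=
        hh'int.bdd_smul B hψc.aestronglyMeasurable (ae_of_all _ hB)
      have hJnn : 0 ≤ ∫ t, ψ t • h' t := integral_nonneg fun t =>
        mul_nonneg (hψnn t) (indicator_nonneg (fun _ _ => ENNReal.toReal_nonneg) _)
      -- The test direction is the mollified vector `w` itself: the hypothesis becomes |w|² ≤ |w| ∫
      -- ψ h', so |w| is at most the mollification of `H`, with no loss from coordinates.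
      have e1 : ‖w‖ ^ 2 = ∫ t in Ω, ψ t * inner ℝ (g t) w := by
        rw [← real_inner_self_eq_norm_sq, real_inner_comm]
        nth_rw 2 [hw]
        rw [← integral_inner hGi w, ← integral_indicator hΩ.measurableSet]
        refine integral_congr_ae (ae_of_all _ fun t => ?_)
        by_cases ht : t ∈ S
        · simp only [hG]
          rw [indicator_of_mem ht, indicator_of_mem (hρΩ ht), inner_smul_right, real_inner_comm]
        · have h0 : ψ t = 0 := image_eq_zero_of_notMem_tsupport fun hc => ht (hψS hc)
          by_cases htΩ : t ∈ Ω
          · rw [indicator_of_mem htΩ]; simp [h0]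
          · rw [indicator_of_notMem htΩ]; simp [h0]
      have e2 : ∫⁻ t in Ω, H t * ‖ψ t‖ₑ = ENNReal.ofReal (∫ t, ψ t • h' t) := by
        rw [ofReal_integral_eq_lintegral_ofReal hJi (ae_of_all _ fun t =>
          mul_nonneg (hψnn t) (indicator_nonneg (fun _ _ => ENNReal.toReal_nonneg) _)),
          ← lintegral_indicator hΩ.measurableSet]
        refine lintegral_congr_ae ?_
        filter_upwards [(ae_restrict_iff' hΩ.measurableSet).1 hHae] with t htH
        by_cases ht : t ∈ Ω
        · rw [hh', indicator_of_mem ht, indicator_of_mem ht, smul_eq_mul,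
            ENNReal.ofReal_mul (hψnn t), ENNReal.ofReal_toReal (htH ht).ne, ← ofReal_norm,
            Real.norm_of_nonneg (hψnn t), mul_comm]
        · rw [hh', indicator_of_notMem ht, indicator_of_notMem ht, smul_zero, ENNReal.ofReal_zero]
      have key := h ψ ((φ k).contDiff_normed_sub x) ((φ k).hasCompactSupport_normed_sub x)
        (hψS.trans hρΩ) w
      rw [← e1, e2, ← ofReal_norm, ← ofReal_norm, ← ENNReal.ofReal_mul (norm_nonneg _),
        ENNReal.ofReal_le_ofReal_iff (mul_nonneg (norm_nonneg _) hJnn), norm_pow, norm_norm, sq] at key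
      rcases (norm_nonneg w).eq_or_lt with h0 | h0
      · rw [← h0]; exact hJnn
      · exact le_of_mul_le_mul_left key h0
    rw [← ofReal_norm]
    exact (ENNReal.ofReal_le_ofReal hle).trans ENNReal.ofReal_toReal_le
  refine ⟨_, ?_, ae_iff.1 hfin⟩
  filter_upwards [self_mem_nhdsWithin, mem_nhdsWithin_of_mem_nhds
    (ball_mem_nhds x₀ (show 0 < ρ / 2 by positivity))] with a ha hab
  exact fun hc => ha fun _ => hc hab

/-- The bound makes `l` vanish on the kernel of `T`, so `l` induces a bounded functional on the
range. Hahn-Banach extends it from the range, which need not be closed, and Riesz represents the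
extension. -/
theorem exists_inner_eq_of_abs_le {V F : Type*} [AddCommGroup V] [Module ℝ V]
    [NormedAddCommGroup F] [InnerProductSpace ℝ F] [CompleteSpace F] (T : V →ₗ[ℝ] F)
    (l : V →ₗ[ℝ] ℝ) (C : ℝ) (h : ∀ v, |l v| ≤ C * ‖T v‖) : ∃ w : F, ∀ v, l v = inner ℝ w (T v) := by
  obtain ⟨S, hS⟩ := T.rangeRestrict.exists_rightInverse_of_surjective T.range_rangeRestrict
  have hTS : ∀ z : LinearMap.range T, T (S z) = z := fun z =>
    congrArg Subtype.val (LinearMap.congr_fun hS z)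
  let l' : StrongDual ℝ (LinearMap.range T) := (l ∘ₗ S).mkContinuous C fun z => by
    have := h (S z)
    rwa [hTS] at this
  obtain ⟨L, hL, -⟩ := exists_extension_norm_eq _ l'
  refine ⟨(InnerProductSpace.toDual ℝ F).symm L, fun v => ?_⟩
  rw [InnerProductSpace.toDual_symm_apply, hL ⟨T v, LinearMap.mem_range_self T v⟩]
  change l v = l (S ⟨T v, _⟩)
  -- `v` and its chosen preimage differ by an element of the kernel of `T`, on which `l` vanishes.
  have h0 := h (v - S ⟨T v, LinearMap.mem_range_self T v⟩)
  rw [map_sub, map_sub, hTS, sub_self, norm_zero, mul_zero] at h0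
  exact sub_eq_zero.1 (abs_nonpos_iff.1 h0)

/-- The space of smooth functions with compact support in `Ω`. -/
def testFunctionSubmodule {n : ℕ} (Ω : Set (EuclideanSpace ℝ (Fin n))) :
    Submodule ℝ (EuclideanSpace ℝ (Fin n) → ℝ) where
  carrier := {φ | ContDiff ℝ ((⊤ : ℕ∞) : WithTop ℕ∞) φ ∧ HasCompactSupport φ ∧ tsupport φ ⊆ Ω}
  add_mem' := fun {φ ψ} hφ hψ => ⟨hφ.1.add hψ.1, hφ.2.1.add hψ.2.1,
    (tsupport_add φ ψ).trans (union_subset hφ.2.2 hψ.2.2)⟩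
  zero_mem' := ⟨contDiff_const, HasCompactSupport.zero, by simp [tsupport]⟩
  smul_mem' := fun c φ hφ => ⟨contDiff_const.smul hφ.1, hφ.2.1.smul_left (f := fun _ => c),
    (tsupport_smul_subset_right (fun _ => c) φ).trans hφ.2.2⟩

/-- For the finite measure μ = H dx on Ω, `l` is bounded in the L¹(μ) norm, hence by Cauchy-Schwarz
in the L²(μ) norm. Its Riesz representative w lies in L²(μ) ⊆ L¹(μ), and g = H w. That |g| ≤ H is
not recorded here; the sharp bound comes from `ae_enorm_le_of_forall_contDiff`. -/
theorem exists_integrable_of_enorm_le {n : ℕ} {Ω : Set (EuclideanSpace ℝ (Fin n))}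
    {H : EuclideanSpace ℝ (Fin n) → ℝ≥0∞} (hH : Measurable H) (hHfin : ∫⁻ x in Ω, H x < ∞)
    (l : testFunctionSubmodule Ω →ₗ[ℝ] ℝ)
    (hl : ∀ φ : testFunctionSubmodule Ω, ‖l φ‖ₑ ≤ ∫⁻ x in Ω, H x * ‖φ.1 x‖ₑ) :
    ∃ g : EuclideanSpace ℝ (Fin n) → ℝ, IntegrableOn g Ω ∧
      ∀ φ : testFunctionSubmodule Ω, l φ = ∫ x in Ω, g x * φ.1 x := by
  set μ := (volume.restrict Ω).withDensity H with hμ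
  have : IsFiniteMeasure μ := isFiniteMeasure_withDensity hHfin.ne
  have hHae : ∀ᵐ x ∂(volume.restrict Ω), H x < ∞ := ae_lt_top hH hHfin.ne
  have hmem : ∀ φ : testFunctionSubmodule Ω, MemLp φ.1 2 μ := fun φ =>
    φ.2.1.continuous.memLp_of_hasCompactSupport φ.2.2.1
  let T : testFunctionSubmodule Ω →ₗ[ℝ] Lp ℝ 2 μ :=
    { toFun := fun φ => (hmem φ).toLp φ.1
      map_add' := fun φ ψ => MemLp.toLp_add (hmem φ) (hmem ψ)
      map_smul' := fun c φ => MemLp.toLp_const_smul c (hmem φ) }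
  obtain ⟨w, hw⟩ := exists_inner_eq_of_abs_le T l 
    ((μ univ ^ (1 / (1 : ℝ≥0∞).toReal - 1 / (2 : ℝ≥0∞).toReal)).toReal) fun φ => by
    have h1 : ∫⁻ x in Ω, H x * ‖φ.1 x‖ₑ = eLpNorm φ.1 1 μ := by
      rw [eLpNorm_one_eq_lintegral_enorm, hμ, lintegral_withDensity_eq_lintegral_mul _ hH
        φ.2.1.continuous.measurable.enorm]
      rfl
    have h2 := (hl φ).trans (h1.le.trans (eLpNorm_le_eLpNorm_mul_rpow_measure_univ
      (by norm_num : (1 : ℝ≥0∞) ≤ 2) (hmem φ).1))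
    have h3 := ENNReal.toReal_mono (ENNReal.mul_ne_top (hmem φ).2.ne
      (ENNReal.rpow_ne_top_of_nonneg (by norm_num) (measure_ne_top _ _))) h2
    rw [toReal_enorm, ENNReal.toReal_mul, mul_comm] at h3
    change |l φ| ≤ _ * ‖(hmem φ).toLp φ.1‖
    rw [Lp.norm_toLp]
    exact h3
  have hwint : Integrable w μ := (Lp.memLp w).integrable one_le_two
  refine ⟨fun x => (H x).toReal * w x, ?_, fun φ => ?_⟩
  · exact (integrable_withDensity_iff_integrable_smul' hH hHae).1 hwint
  · rw [hw, L2.inner_def]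
    have : ∫ x, inner ℝ (w x) (T φ x) ∂μ = ∫ x, w x * φ.1 x ∂μ := by
      refine integral_congr_ae ?_
      filter_upwards [(hmem φ).coeFn_toLp] with x hx
      change inner ℝ (w x) ((hmem φ).toLp φ.1 x) = _
      rw [hx, real_inner_eq_re_inner, RCLike.inner_apply]
      simp [mul_comm]
    rw [this]
    refine (integral_withDensity_eq_integral_toReal_smul hH hHae _).trans ?_
    simp_rw [smul_eq_mul, mul_assoc]

/-- A function whose distributional derivatives are dominated by an integrable `H` has a weak
gradient. -/
theorem exists_hasWeakGradient {n : ℕ} {Ω : Set (EuclideanSpace ℝ (Fin n))}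
    {v : EuclideanSpace ℝ (Fin n) → ℝ} (hv : LocallyIntegrableOn v Ω)
    {H : EuclideanSpace ℝ (Fin n) → ℝ≥0∞} (hH : Measurable H) (hHfin : ∫⁻ x in Ω, H x < ∞)
    (h : ∀ φ : EuclideanSpace ℝ (Fin n) → ℝ, ContDiff ℝ ((⊤ : ℕ∞) : WithTop ℕ∞) φ →
      HasCompactSupport φ → tsupport φ ⊆ Ω → ∀ e : EuclideanSpace ℝ (Fin n),
      ‖∫ x in Ω, v x * fderiv ℝ φ x e‖ₑ ≤ ‖e‖ₑ * ∫⁻ x in Ω, H x * ‖φ x‖ₑ) :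
    ∃ g, HasWeakGradient Ω v g := by
  have hint : ∀ (φ : testFunctionSubmodule Ω) (e : EuclideanSpace ℝ (Fin n)),
      Integrable (fun x => v x * fderiv ℝ φ.1 x e) (volume.restrict Ω) := by
    intro φ e
    have hc : HasCompactSupport fun x => fderiv ℝ φ.1 x e := φ.2.2.1.fderiv_apply (𝕜 := ℝ) _
    have := hv.integrable_smul_of_tsupport_subset
      ((φ.2.1.continuous_fderiv (by simp)).clm_apply continuous_const) hc
      ((tsupport_fderiv_apply_subset ℝ _).trans φ.2.2.2)
    simpa [mul_comm] using this.restrict (s := Ω)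
  have hdiff : ∀ (φ : testFunctionSubmodule Ω) x, DifferentiableAt ℝ φ.1 x := fun φ x =>
    φ.2.1.differentiable (by simp) x
  have hex : ∀ i : Fin n, ∃ g : EuclideanSpace ℝ (Fin n) → ℝ, IntegrableOn g Ω ∧
      ∀ φ : testFunctionSubmodule Ω, - ∫ x in Ω, v x * fderiv ℝ φ.1 x (EuclideanSpace.single i 1) =
        ∫ x in Ω, g x * φ.1 x := by
    intro i
    let l : testFunctionSubmodule Ω →ₗ[ℝ] ℝ :=
      { toFun := fun φ => - ∫ x in Ω, v x * fderiv ℝ φ.1 x (EuclideanSpace.single i 1)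
        map_add' := fun φ ψ => by
          rw [← neg_add, ← integral_add (hint φ _) (hint ψ _)]
          congr 1
          refine integral_congr_ae (ae_of_all _ fun x => ?_)
          simp only [Submodule.coe_add]
          rw [fderiv_add (hdiff φ x) (hdiff ψ x), add_apply, mul_add]
        map_smul' := fun c φ => by
          rw [RingHom.id_apply, smul_eq_mul, mul_neg, ← integral_const_mul]
          congr 1
          refine integral_congr_ae (ae_of_all _ fun x => ?_)
          simp only [Submodule.coe_smul]
          rw [fderiv_const_smul (hdiff φ x), smul_apply, smul_eq_mul]
          ring }
    refine exists_integrable_of_enorm_le hH hHfin l fun φ => ?_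
    change ‖- ∫ x in Ω, v x * fderiv ℝ φ.1 x (EuclideanSpace.single i 1)‖ₑ ≤ _
    have := h φ.1 φ.2.1 φ.2.2.1 φ.2.2.2 (EuclideanSpace.single i 1)
    rw [enorm_neg]
    refine this.trans (le_of_eq ?_)
    rw [← ofReal_norm, PiLp.norm_single, norm_one, ENNReal.ofReal_one, one_mul]
  choose g hg hgφ using hex
  refine ⟨fun x => WithLp.toLp 2 fun i => g i x, hv, ?_, fun φ hφ hφc hφΩ i => ?_⟩
  · exact IntegrableOn.locallyIntegrableOn (Integrable.of_eval_piLp fun i => hg i)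
  · rw [← neg_eq_iff_eq_neg]
    exact hgφ i ⟨φ, hφ, hφc, hφΩ⟩

/-! ### Uniqueness of weak gradients and the main theorem -/

theorem HasWeakGradient.congr {n : ℕ} {Ω : Set (EuclideanSpace ℝ (Fin n))}
    {u u' : EuclideanSpace ℝ (Fin n) → ℝ}
    {g g' : EuclideanSpace ℝ (Fin n) → EuclideanSpace ℝ (Fin n)} (h : HasWeakGradient Ω u g)
    (hu : u =ᵐ[volume.restrict Ω] u') (hg : g =ᵐ[volume.restrict Ω] g') :
    HasWeakGradient Ω u' g' := by
  refine ⟨h.1.congr hu, h.2.1.congr hg, fun φ hφ hφc hφΩ i => ?_⟩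
  have e1 : ∫ x in Ω, u' x * fderiv ℝ φ x (EuclideanSpace.single i 1) =
      ∫ x in Ω, u x * fderiv ℝ φ x (EuclideanSpace.single i 1) :=
    integral_congr_ae (hu.mono fun x hx => by simp only [hx])
  have e2 : ∫ x in Ω, g' x i * φ x = ∫ x in Ω, g x i * φ x :=
    integral_congr_ae (hg.mono fun x hx => by simp only [hx])
  rw [e1, e2]
  exact h.2.2 φ hφ hφc hφΩ i

theorem HasWeakGradient.ae_enorm_le {n : ℕ} {Ω : Set (EuclideanSpace ℝ (Fin n))} (hΩ : IsOpen Ω)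
    {v : EuclideanSpace ℝ (Fin n) → ℝ} {g : EuclideanSpace ℝ (Fin n) → EuclideanSpace ℝ (Fin n)}
    (hv : HasWeakGradient Ω v g) {H : EuclideanSpace ℝ (Fin n) → ℝ≥0∞} (hH : Measurable H)
    (hHfin : ∫⁻ x in Ω, H x < ∞)
    (h : ∀ φ : EuclideanSpace ℝ (Fin n) → ℝ, ContDiff ℝ ((⊤ : ℕ∞) : WithTop ℕ∞) φ →
      HasCompactSupport φ → tsupport φ ⊆ Ω → ∀ e : EuclideanSpace ℝ (Fin n),
      ‖∫ x in Ω, v x * fderiv ℝ φ x e‖ₑ ≤ ‖e‖ₑ * ∫⁻ x in Ω, H x * ‖φ x‖ₑ) :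
    ∀ᵐ x ∂(volume.restrict Ω), ‖g x‖ₑ ≤ H x := by
  refine ae_enorm_le_of_forall_contDiff hΩ hv.2.1 hH hHfin fun φ hφ hφc hφΩ e => ?_
  have := h φ hφ hφc hφΩ e
  rwa [hv.integral_mul_fderiv hφ hφc hφΩ, enorm_neg] at this

/-- The difference is a weak gradient of the zero function, so the domination principle applies with
H = 0. -/
theorem HasWeakGradient.ae_eq {n : ℕ} {Ω : Set (EuclideanSpace ℝ (Fin n))} (hΩ : IsOpen Ω)
    {u : EuclideanSpace ℝ (Fin n) → ℝ} {g g' : EuclideanSpace ℝ (Fin n) → EuclideanSpace ℝ (Fin n)}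
    (h : HasWeakGradient Ω u g) (h' : HasWeakGradient Ω u g') : g =ᵐ[volume.restrict Ω] g' := by
  have h0 : HasWeakGradient Ω (fun _ => 0) (g - g') := by
    refine ⟨locallyIntegrableOn_zero, h.2.1.sub h'.2.1, fun φ hφ hφc hφΩ i => ?_⟩
    have hi : ∀ {G : EuclideanSpace ℝ (Fin n) → EuclideanSpace ℝ (Fin n)},
        LocallyIntegrableOn G Ω → Integrable (fun x => G x i * φ x) (volume.restrict Ω) := by
      intro G hG
      have := (hG.integrable_smul_of_tsupport_subset hφ.continuous hφc hφΩ).restrict (s := Ω)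
      simpa [mul_comm] using
        (EuclideanSpace.proj (𝕜 := ℝ) i : EuclideanSpace ℝ (Fin n) →L[ℝ] ℝ).integrable_comp this
    simp only [zero_mul, integral_zero, Pi.sub_apply, PiLp.sub_apply, sub_mul]
    rw [integral_sub (hi h.2.1) (hi h'.2.1), eq_comm, neg_eq_zero, sub_eq_zero, ← neg_inj,
      ← h.2.2 φ hφ hφc hφΩ i, ← h'.2.2 φ hφ hφc hφΩ i]
  filter_upwards [h0.ae_enorm_le hΩ (H := fun _ => 0) measurable_const (by simp) (by simp)] with x hx
  simpa [sub_eq_zero] using hx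

theorem memLp_of_enorm_le {X F : Type*} [MeasurableSpace X] {μ : Measure X} [NormedAddCommGroup F]
    {f : X → F} {H : X → ℝ≥0∞} {q : ℝ} (hq : 0 < q) (hf : AEStronglyMeasurable f μ)
    (hfH : ∀ᵐ x ∂μ, ‖f x‖ₑ ≤ H x) (hH : ∫⁻ x, H x ^ q ∂μ < ∞) : MemLp f (ENNReal.ofReal q) μ := by
  refine ⟨hf, ?_⟩
  rw [eLpNorm_lt_top_iff_lintegral_rpow_enorm_lt_top (by simpa using hq) ENNReal.ofReal_ne_top,
    ENNReal.toReal_ofReal hq.le]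
  refine (lintegral_mono_ae ?_).trans_lt hH
  filter_upwards [hfH] with x hx
  exact ENNReal.rpow_le_rpow hx hq.le

/-- Ensures that the distance to the complement is a finite real number, as the scaled radii in the
segment inequality require. -/
theorem compl_nonempty_of_volume_lt_top {n : ℕ} (hn : 0 < n) {Ω : Set (EuclideanSpace ℝ (Fin n))}
    (hΩ : volume Ω < ∞) : Ωᶜ.Nonempty := by
  by_contra h
  rw [not_nonempty_iff_eq_empty, compl_empty_iff] at h
  have : Nontrivial (EuclideanSpace ℝ (Fin n)) :=
    Module.nontrivial_of_finrank_pos (R := ℝ) (by rwa [finrank_euclideanSpace_fin])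
  have : NoncompactSpace (EuclideanSpace ℝ (Fin n)) := NormedSpace.noncompactSpace ℝ _
  rw [h, measure_univ_of_isAddLeftInvariant] at hΩ
  exact lt_irrefl _ hΩ

theorem mainTheorem4 (n : ℕ) (p α : ℝ) (hp : 1 < p) (hpn : p < n) (hα : 1 ≤ α)
    (hαn : α < n / p) (Ω : Set (EuclideanSpace ℝ (Fin n))) (hΩ : IsOpen Ω)
    (hvol : volume Ω < ∞) (u : EuclideanSpace ℝ (Fin n) → ℝ)
    (hu : MemSobolevOne (ENNReal.ofReal p) Ω u) :
    (∀ᵐ x ∂(volume.restrict Ω), localFracMax α Ω u x < ∞) ∧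
    MemSobolevOne (ENNReal.ofReal (n * p / (n - (α - 1) * p))) Ω
      (fun x => (localFracMax α Ω u x).toReal) ∧
    ∀ Du DM : EuclideanSpace ℝ (Fin n) → EuclideanSpace ℝ (Fin n),
      HasWeakGradient Ω u Du →
      HasWeakGradient Ω (fun x => (localFracMax α Ω u x).toReal) DM →
      ∀ᵐ x ∂(volume.restrict Ω),
        ‖DM x‖ₑ ≤ 2 * localFracMax α Ω (fun y => ‖Du y‖) x
          + ENNReal.ofReal α * localFracMax (α - 1) Ω u x := by
  obtain ⟨huLp, g, hug, hgLp⟩ := hu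
  have hp0 : 0 < p := by linarith
  have hn : (0 : ℝ) < n := by linarith
  have hαp : α * p < n := (lt_div_iff₀ hp0).1 hαn
  have hβp : (α - 1) * p < n := by linarith [sub_mul α 1 p]
  have hΩc := compl_nonempty_of_volume_lt_top (by exact_mod_cast hn) hvol
  have : IsFiniteMeasure (volume.restrict Ω) := isFiniteMeasure_restrict.2 hvol.ne
  set q := n * p / (n - (α - 1) * p) with hq
  have hβ0 : 0 ≤ (α - 1) * p := mul_nonneg (by linarith) hp0.le
  have hq1 : 1 ≤ q := by
    rw [hq, le_div_iff₀ (by linarith)]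
    nlinarith
  -- The exponent on the right is the one that M_α attains on L^p; finite volume lowers it to q. The
  -- term M_{α-1} u lies in L^q directly.
  have hqs : q ≤ n * p / (n - α * p) := by
    have h1 : 0 < n - α * p := by linarith
    rw [hq]
    gcongr
    linarith
  have hq0 : 0 < q := by linarith
  have hMα : ∀ {w : EuclideanSpace ℝ (Fin n) → ℝ}, MemLp w (ENNReal.ofReal p) (volume.restrict Ω) →
      ∫⁻ x in Ω, localFracMax α Ω w x ^ q < ∞ := fun hw =>
    lintegral_rpow_lt_top_of_le hq0.le hqs ((setLIntegral_le_lintegral _ _).trans_lt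
      (lintegral_localFracMax_rpow_lt_top hΩ.measurableSet hp hw (by linarith) hαp))
  have hMβ : ∫⁻ x in Ω, localFracMax (α - 1) Ω u x ^ q < ∞ :=
    (setLIntegral_le_lintegral _ _).trans_lt
      (lintegral_localFracMax_rpow_lt_top hΩ.measurableSet hp huLp (by linarith) hβp)
  set M := localFracMax α Ω u with hM
  have hMm : Measurable M := measurable_localFracMax _ _ _
  have hMq := hMα huLp
  have hone : ∀ {f : EuclideanSpace ℝ (Fin n) → ℝ≥0∞}, ∫⁻ x in Ω, f x ^ q < ∞ →
      ∫⁻ x in Ω, f x < ∞ := fun {f} hf => by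
    simpa using lintegral_rpow_lt_top_of_le (q := 1) zero_le_one hq1 hf
  have hMfin := hone hMq
  set H : EuclideanSpace ℝ (Fin n) → ℝ≥0∞ := fun x =>
    2 * localFracMax α Ω (fun y => ‖g y‖) x + ENNReal.ofReal α * localFracMax (α - 1) Ω u x with hH
  have hHm : Measurable H := ((measurable_localFracMax _ _ _).const_mul _).add
    ((measurable_localFracMax _ _ _).const_mul _)
  have hHq : ∫⁻ x in Ω, H x ^ q < ∞ := by
    refine ENNReal.lintegral_rpow_add_lt_top_of_lintegral_rpow_lt_top
      ((measurable_localFracMax _ _ _).const_mul _).aemeasurable ?_ ?_ hq1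
    · simp_rw [ENNReal.mul_rpow_of_nonneg _ _ hq0.le]
      rw [lintegral_const_mul' _ _ (by finiteness)]
      exact ENNReal.mul_lt_top (by finiteness) (hMα hgLp.norm)
    · simp_rw [ENNReal.mul_rpow_of_nonneg _ _ hq0.le]
      rw [lintegral_const_mul' _ _ (ENNReal.rpow_ne_top_of_nonneg hq0.le ENNReal.ofReal_ne_top)]
      exact ENNReal.mul_lt_top (ENNReal.rpow_lt_top_of_nonneg hq0.le ENNReal.ofReal_ne_top) hMβ
  have hHfin := hone hHq
  have hseg : ∀ x v : EuclideanSpace ℝ (Fin n), (∀ θ ∈ Icc (0 : ℝ) 1, x + θ • v ∈ Ω) →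
      M (x + v) ≤ M x + ‖v‖ₑ * ∫⁻ θ in Icc (0 : ℝ) 1, H (x + θ • v) := by
    -- The segment inequality is proved for Borel representatives and passes to `u` and `g` at every
    -- point, since their maximal functions coincide everywhere.
    obtain ⟨u', hu'm, hu'⟩ := huLp.1.aemeasurable
    obtain ⟨g', hg'm, hg'⟩ := hgLp.1.aemeasurable
    intro x v hxv
    have key := (hug.congr hu' hg').localFracMax_le_add hΩ hΩc hu'm hg'm (zero_le_one.trans hα) hxv
    have e : ∀ β, localFracMax β Ω u' = localFracMax β Ω u := fun β =>
      localFracMax_congr (hu'.mono fun x hx => by rw [hx])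
    have e' : localFracMax α Ω (fun y => ‖g' y‖) = localFracMax α Ω (fun y => ‖g y‖) :=
      localFracMax_congr (hg'.mono fun x hx => by simp only [hx])
    rwa [e, e, e'] at key
  have hD : ∀ φ : EuclideanSpace ℝ (Fin n) → ℝ, ContDiff ℝ ((⊤ : ℕ∞) : WithTop ℕ∞) φ →
      HasCompactSupport φ → tsupport φ ⊆ Ω → ∀ e : EuclideanSpace ℝ (Fin n),
      ‖∫ x in Ω, (M x).toReal * fderiv ℝ φ x e‖ₑ ≤ ‖e‖ₑ * ∫⁻ x in Ω, H x * ‖φ x‖ₑ :=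
    fun φ hφ hφc hφΩ e => enorm_integral_mul_fderiv_le_of_segment hΩ hMm hHm hMfin hHfin hseg
      hφ hφc hφΩ e
  have hMint : IntegrableOn (fun x => (M x).toReal) Ω :=
    integrable_toReal_of_lintegral_ne_top hMm.aemeasurable hMfin.ne
  refine ⟨ae_lt_top hMm hMfin.ne, ⟨?_, ?_⟩, fun Du DM hDu hDM => ?_⟩
  · refine memLp_of_enorm_le hq0 hMint.aestronglyMeasurable (ae_of_all _ fun x => ?_) hMq
    rw [Real.enorm_of_nonneg ENNReal.toReal_nonneg]
    exact ENNReal.ofReal_toReal_le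
  · obtain ⟨G, hG⟩ := exists_hasWeakGradient hMint.locallyIntegrableOn hHm hHfin hD
    refine ⟨G, hG, memLp_of_enorm_le hq0 ?_ (hG.ae_enorm_le hΩ hHm hHfin hD) hHq⟩
    exact hG.2.1.aestronglyMeasurable
  -- `H` was built from one chosen weak gradient `g`; uniqueness makes the bound hold for any `Du`.
  · have e : localFracMax α Ω (fun y => ‖Du y‖) = localFracMax α Ω (fun y => ‖g y‖) :=
      localFracMax_congr ((hDu.ae_eq hΩ hug).mono fun x hx => by simp only [hx])
    rw [e]
    exact hDM.ae_enorm_le hΩ hHm hHfin hD
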